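/- Let $\mathcal A\subset B(\ell^2(\mathbb N))$ be the operator algebra of upper triangular compact operators, that is, of the compact $T$ with $\langle Te_j,e_i\rangle=0$ for $i>j$. A C*-cover of $\mathcal A$ is a pair $(\mathcal B,\iota)$ of a C*-algebra $\mathcal B$ and a completely isometric homomorphism $\iota:\mathcal A\to\mathcal B$ with $C^*(\iota(\mathcal A))=\mathcal B$. Write $(\mathcal B,\iota)\preceq(\mathcal C,j)$ if there is a $*$-homomorphism $\pi:\mathcal C\to\mathcal B$ (a morphism of C*-covers) with $\pi j=\iota$; this is a partial order on the set of equivalence classes $[\mathcal B,\iota]$ of C*-covers, and meets are greatest lower bounds for it. A C*-cover $(\mathcal B,\iota)$ is residually finite-dimensional (RFD) if the $*$-homomorphisms of $\mathcal B$ into matrix algebras $M_n$ separate the points of $\mathcal B$. Let $V_n:\mathbb C^n\to\ell^2(\mathbb N)$ be the isometry onto the span of the first $n$ standard basis vectors and let $\rho_n:\mathcal A\to M_n$, $\rho_n(T)=V_n^*TV_n$ (for $n=0$, $M_0=\{0\}$). Then: (1) $C^*(\mathcal A)=K(\ell^2(\mathbb N))$, and the meet of all RFD C*-covers of $\mathcal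 A$ is $[K(\ell^2(\mathbb N)),\mathrm{id}]$. Moreover, for every $m\ge 0$ the homomorphism $\bigoplus_{n\ge m}\rho_n:\mathcal A\to\prod_{n\ge m}M_n$ is completely isometric and $\mathcal R_m=C^*\big((\bigoplus_{n\ge m}\rho_n)(\mathcal A)\big)$ is an RFD C*-cover of $\mathcal A$; these covers form a decreasing chain, and $$\bigwedge_{m}\Big[\mathcal R_m,\bigoplus_{n\ge m}\rho_n\Big]=[K(\ell^2(\mathbb N)),\mathrm{id}],$$ where $K(\ell^2(\mathbb N))$ is the inductive limit $\varinjlim_m\mathcal R_m$ along the morphisms of C*-covers $\mathcal R_m\to\mathcal R_{m'}$, $m\le m'$, with the morphisms of C*-covers $\mathcal R_m\to K(\ell^2(\mathbb N))$ as canonical maps. (2) The set of RFD C*-covers of $\mathcal A$ has no minimum: no RFD C*-cover of $\mathcal A$ is $\preceq$ every RFD C*-cover of $\mathcal A$. -/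

import Mathlib

open scoped ENNReal

universe u v w

noncomputable section

namespace OperatorAlgebra

/-! ### Operator algebras, complete isometries and C⋆-covers -/

section Covers

/-- The C⋆-norm on `M_n(B)`, for a C⋆-algebra `B`. (Mathlib's norm on `CStarMatrix` asks for an order
on `B`; the only order compatible with the C⋆-structure is the spectral order, and it is used here.)
For `B = B(H)` this is the operator norm on `M_n(B(H)) = B(Hⁿ)`. -/
def matrixNorm {B : Type u} [NonUnitalCStarAlgebra B] {n : ℕ} (M : Matrix (Fin n) (Fin n) B) : ℝ :=
  letI := CStarAlgebra.spectralOrder B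
  letI := CStarAlgebra.spectralOrderedRing B
  ‖CStarMatrix.ofMatrix M‖

/-- An injective ⋆-homomorphism of C⋆-algebras preserves the matrix norms. -/
theorem matrixNorm_map {B : Type u} {C : Type v} [NonUnitalCStarAlgebra B]
    [NonUnitalCStarAlgebra C] (f : B →⋆ₙₐ[ℂ] C) (hf : Function.Injective f) {n : ℕ}
    (M : Matrix (Fin n) (Fin n) B) : matrixNorm (M.map f) = matrixNorm M := by
  let _ := CStarAlgebra.spectralOrder B
  let _ := CStarAlgebra.spectralOrderedRing B
  let _ := CStarAlgebra.spectralOrder C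
  let _ := CStarAlgebra.spectralOrderedRing C
  have hinj : Function.Injective (CStarMatrix.mapₙₐ (n := Fin n) f) := by
    intro X Y h
    exact CStarMatrix.map_injective hf h
  exact NonUnitalStarAlgHom.norm_map (CStarMatrix.mapₙₐ (n := Fin n) f) hinj
    (CStarMatrix.ofMatrix M)

variable {H : Type w} [NormedAddCommGroup H] [InnerProductSpace ℂ H]

/-- The C⋆-algebra `C*(θ(A)) ⊆ B` generated by the range of `θ : A → B`. -/
def cstarGenerated {A : NonUnitalSubalgebra ℂ (H →L[ℂ] H)} {B : Type u}
    [NonUnitalCStarAlgebra B] (θ : A →ₙₐ[ℂ] B) : NonUnitalStarSubalgebra ℂ B :=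
  (NonUnitalStarAlgebra.adjoin ℂ (Set.range θ)).topologicalClosure

instance isClosed_cstarGenerated {A : NonUnitalSubalgebra ℂ (H →L[ℂ] H)} {B : Type u}
    [NonUnitalCStarAlgebra B] (θ : A →ₙₐ[ℂ] B) : IsClosed (cstarGenerated θ : Set B) :=
  NonUnitalStarSubalgebra.isClosed_topologicalClosure _

theorem mem_cstarGenerated {A : NonUnitalSubalgebra ℂ (H →L[ℂ] H)} {B : Type u}
    [NonUnitalCStarAlgebra B] (θ : A →ₙₐ[ℂ] B) (a : A) : θ a ∈ cstarGenerated θ :=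
  NonUnitalStarSubalgebra.le_topologicalClosure _
    (NonUnitalStarAlgebra.subset_adjoin ℂ _ ⟨a, rfl⟩)

/-- `θ : A → B` with the codomain restricted to `C*(θ(A))`. -/
def toGenerated {A : NonUnitalSubalgebra ℂ (H →L[ℂ] H)} {B : Type u}
    [NonUnitalCStarAlgebra B] (θ : A →ₙₐ[ℂ] B) : A →ₙₐ[ℂ] cstarGenerated θ where
  toFun a := ⟨θ a, mem_cstarGenerated θ a⟩
  map_smul' c a := Subtype.ext (map_smul θ c a)
  map_zero' := Subtype.ext (map_zero θ)
  map_add' a b := Subtype.ext (map_add θ a b)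
  map_mul' a b := Subtype.ext (map_mul θ a b)

variable [CompleteSpace H]

/-- A homomorphism from an operator algebra `A ⊆ B(H)` to a C⋆-algebra `B` is completely isometric if
all its amplifications `M_n(A) → M_n(B)` are isometric, where `M_n(A) ⊆ M_n(B(H))`. -/
def IsCompletelyIsometric {A : NonUnitalSubalgebra ℂ (H →L[ℂ] H)} {B : Type u}
    [NonUnitalCStarAlgebra B] (θ : A →ₙₐ[ℂ] B) : Prop :=
  ∀ (n : ℕ) (M : Matrix (Fin n) (Fin n) A),
    matrixNorm (M.map θ) = matrixNorm (M.map (fun a : A => (a : H →L[ℂ] H)))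

/-- A C⋆-cover of the operator algebra `A ⊆ B(H)`: a C⋆-algebra together with a completely isometric
homomorphism of `A` into it whose range generates it as a C⋆-algebra. -/
structure CStarCover (A : NonUnitalSubalgebra ℂ (H →L[ℂ] H)) where
  carrier : Type u
  [cstar : NonUnitalCStarAlgebra carrier]
  ι : A →ₙₐ[ℂ] carrier
  completelyIsometric : IsCompletelyIsometric ι
  generates : cstarGenerated ι = ⊤

attribute [instance] CStarCover.cstar

variable {A : NonUnitalSubalgebra ℂ (H →L[ℂ] H)}

/-- `(B, ι) ≼ (C, j)` if and only if there is a ⋆-homomorphism `π : C → B` with `π ∘ j = ι`. -/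
instance : Preorder (CStarCover.{u} A) where
  le B C := ∃ π : C.carrier →⋆ₙₐ[ℂ] B.carrier, ∀ a, π (C.ι a) = B.ι a
  le_refl B := ⟨NonUnitalStarAlgHom.id ℂ B.carrier, fun _ => rfl⟩
  le_trans B C D := by
    rintro ⟨π, hπ⟩ ⟨σ, hσ⟩
    exact ⟨π.comp σ, fun a => by simp [hσ, hπ]⟩

variable (A) in
/-- The partially ordered set of equivalence classes `[B, ι]` of C⋆-covers of `A`; meets are
greatest lower bounds in this partial order. (A C⋆-cover of a norm-separable `A` is separable, so for
such an `A` every C⋆-cover is equivalent to one whose carrier lives in `Type`, and `CStarLat.{0} A`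
contains all equivalence classes.) -/
abbrev CStarLat := Antisymmetrization (CStarCover.{u} A) (· ≤ ·)

/-- The equivalence class `[B, ι]` of a C⋆-cover. -/
abbrev CStarCover.cls (B : CStarCover.{u} A) : CStarLat.{u} A := toAntisymmetrization (· ≤ ·) B

/-- The C⋆-cover `(C*(θ(A)), θ)` determined by a completely isometric homomorphism `θ`. -/
def CStarCover.ofHom {B : Type u} [NonUnitalCStarAlgebra B] (θ : A →ₙₐ[ℂ] B)
    (hθ : IsCompletelyIsometric θ) : CStarCover.{u} A where
  carrier := cstarGenerated θ
  ι := toGenerated θ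
  completelyIsometric n M := by
    rw [← hθ n M, ← matrixNorm_map (NonUnitalStarSubalgebraClass.subtype (cstarGenerated θ))
      Subtype.val_injective]
    rfl
  generates := by
    set S := cstarGenerated θ with hS
    let f : S →⋆ₙₐ[ℂ] B := NonUnitalStarSubalgebraClass.subtype S
    have hle : NonUnitalStarAlgebra.adjoin ℂ (Set.range θ) ≤
        (NonUnitalStarAlgebra.adjoin ℂ (Set.range (toGenerated θ))).map f := by
      refine NonUnitalStarAlgebra.adjoin_le ?_
      rintro _ ⟨a, rfl⟩
      exact ⟨toGenerated θ a, NonUnitalStarAlgebra.subset_adjoin ℂ _ ⟨a, rfl⟩, rfl⟩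
    refine eq_top_iff.2 fun x _ => ?_
    change x ∈ closure (NonUnitalStarAlgebra.adjoin ℂ (Set.range (toGenerated θ)) : Set S)
    rw [closure_subtype]
    exact closure_mono hle x.2

/-- A C⋆-algebra is residually finite-dimensional if its ⋆-homomorphisms into the matrix algebras
`M_n` separate its points, that is, if it embeds into a product of matrix algebras. -/
def IsRFD (B : Type u) [NonUnitalCStarAlgebra B] : Prop :=
  ∀ b : B, b ≠ 0 → ∃ (n : ℕ) (π : B →⋆ₙₐ[ℂ] Matrix (Fin n) (Fin n) ℂ), π b ≠ 0

variable (A) in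
/-- The residually finite-dimensional C⋆-covers of `A`, up to equivalence. -/
def rfdCovers : Set (CStarLat.{u} A) :=
  {x | ∃ B : CStarCover.{u} A, IsRFD B.carrier ∧ B.cls = x}

variable (A) in
/-- The C⋆-cover `(C*(A), id)`, with `C*(A) ⊆ B(H)` generated by `A` itself. -/
def inclusionCover : CStarCover.{w} A :=
  .ofHom (NonUnitalSubalgebraClass.subtype A) (fun _ _ => rfl)

end Covers

/-- `L`, with the ⋆-homomorphisms `ψ i : B i → L`, is the inductive limit, in the category of
C⋆-algebras, of the system of C⋆-algebras `B 0 → B 1 → B 2 → ⋯` with connecting maps `π`. -/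
def IsInductiveLimit {B : ℕ → Type u} [∀ i, NonUnitalCStarAlgebra (B i)]
    (π : ∀ i j, i ≤ j → B i →⋆ₙₐ[ℂ] B j)
    {L : Type u} [NonUnitalCStarAlgebra L] (ψ : ∀ i, B i →⋆ₙₐ[ℂ] L) : Prop :=
  (∀ i j (h : i ≤ j) (b : B i), ψ j (π i j h b) = ψ i b) ∧
  ∀ (D : Type v) [NonUnitalCStarAlgebra D] (χ : ∀ i, B i →⋆ₙₐ[ℂ] D),
    (∀ i j (h : i ≤ j) (b : B i), χ j (π i j h b) = χ i b) →
    ∃! Φ : L →⋆ₙₐ[ℂ] D, ∀ i (b : B i), Φ (ψ i b) = χ i b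

/-! ### The upper triangular compact operators on `ℓ²(ℕ)` -/

/-- The Hilbert space `ℓ²(ℕ)`. -/
abbrev Ell2 : Type := lp (fun _ : ℕ => ℂ) 2

/-- The standard basis vector `e_j` of `ℓ²(ℕ)`. -/
def e (j : ℕ) : Ell2 := lp.single 2 j 1

theorem e_apply (j k : ℕ) : (e j : ℕ → ℂ) k = if k = j then 1 else 0 := by
  simp [e, lp.single_apply, Pi.single_apply]

theorem orthonormal_e : Orthonormal ℂ e := by
  rw [orthonormal_iff_ite]
  intro i j
  rw [e, lp.inner_single_left]
  simp [e_apply]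

/-- An operator on `ℓ²(ℕ)` is upper triangular if its matrix entries below the diagonal vanish. -/
def IsUpperTriangular (T : Ell2 →L[ℂ] Ell2) : Prop :=
  ∀ i j : ℕ, j < i → (T (e j) : ℕ → ℂ) i = 0

/-- The isometry `V_n : ℂⁿ → ℓ²(ℕ)` onto the span of the first `n` basis vectors. -/
def V (n : ℕ) : EuclideanSpace ℂ (Fin n) →ₗᵢ[ℂ] Ell2 :=
  ((EuclideanSpace.basisFun (Fin n) ℂ).toBasis.constr ℂ
    (fun i : Fin n => e i)).isometryOfOrthonormal
    (v := (EuclideanSpace.basisFun (Fin n) ℂ).toBasis)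
    (by simpa only [OrthonormalBasis.coe_toBasis] using (EuclideanSpace.basisFun (Fin n) ℂ).orthonormal)
    (by
      have : (fun i : Fin n => e i) = e ∘ (fun i : Fin n => (i : ℕ)) := rfl
      convert orthonormal_e.comp (fun i : Fin n => (i : ℕ)) Fin.val_injective using 1
      funext i
      simp only [Function.comp, Module.Basis.constr_basis])

theorem V_apply (n : ℕ) (x : EuclideanSpace ℂ (Fin n)) : V n x = ∑ i : Fin n, x i • e i := by
  change (EuclideanSpace.basisFun (Fin n) ℂ).toBasis.constr ℂ (fun i : Fin n => e i) x = _
  rw [Module.Basis.constr_apply_fintype]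
  simp

theorem V_apply_apply (n : ℕ) (x : EuclideanSpace ℂ (Fin n)) (k : ℕ) :
    (V n x : ℕ → ℂ) k = if h : k < n then x ⟨k, h⟩ else 0 := by
  have h1 : (V n x : ℕ → ℂ) k = ∑ i : Fin n, x i * (if k = i then 1 else 0) := by
    rw [V_apply, lp.coeFn_sum, Finset.sum_apply]
    refine Finset.sum_congr rfl fun i _ => ?_
    rw [lp.coeFn_smul, Pi.smul_apply, e_apply, smul_eq_mul]
  rw [h1]
  split_ifs with h
  · rw [Finset.sum_eq_single (⟨k, h⟩ : Fin n)]
    · simp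
    · intro b _ hb
      have : k ≠ b := fun hk => hb (Fin.ext hk.symm)
      simp [this]
    · simp
  · refine Finset.sum_eq_zero fun i _ => ?_
    have : k ≠ i := fun hk => h (hk ▸ i.2)
    simp [this]

/-- A vector whose coordinates from `n` on vanish lies in the range of `V n`. -/
theorem eq_V (n : ℕ) (y : Ell2) (hy : ∀ k, n ≤ k → (y : ℕ → ℂ) k = 0) :
    V n (WithLp.toLp 2 fun i : Fin n => (y : ℕ → ℂ) i) = y := by
  ext k
  rw [V_apply_apply]
  split_ifs with h
  · rfl
  · exact (hy k (not_lt.1 h)).symm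

/-- An upper triangular operator leaves the span of the first `n` basis vectors invariant. -/
theorem IsUpperTriangular.exists_V {T : Ell2 →L[ℂ] Ell2} (hT : IsUpperTriangular T) (n : ℕ)
    (x : EuclideanSpace ℂ (Fin n)) : ∃ z, T (V n x) = V n z := by
  refine ⟨_, (eq_V n (T (V n x)) fun k hk => ?_).symm⟩
  rw [V_apply, map_sum, lp.coeFn_sum, Finset.sum_apply]
  refine Finset.sum_eq_zero fun i _ => ?_
  rw [map_smul, lp.coeFn_smul, Pi.smul_apply, hT k i (i.2.trans_le hk), smul_zero]

theorem IsUpperTriangular.mul {S T : Ell2 →L[ℂ] Ell2} (hS : IsUpperTriangular S)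
    (hT : IsUpperTriangular T) : IsUpperTriangular (S * T) := by
  intro i j hij
  have hj : V (j + 1) (EuclideanSpace.single (Fin.last j) 1) = e j := by
    rw [V_apply, Finset.sum_eq_single (Fin.last j)]
    · simp
    · intro b _ hb
      simp [hb]
    · simp
  obtain ⟨z, hz⟩ := hT.exists_V (j + 1) (EuclideanSpace.single (Fin.last j) 1)
  obtain ⟨z', hz'⟩ := hS.exists_V (j + 1) z
  rw [mul_apply_eq_comp, ← hj, hz, hz', V_apply_apply, dif_neg (by omega)]

/-- The operator algebra of upper triangular compact operators on `ℓ²(ℕ)`. -/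
def triCompact : NonUnitalSubalgebra ℂ (Ell2 →L[ℂ] Ell2) where
  carrier := {T | IsUpperTriangular T ∧ IsCompactOperator T}
  add_mem' {S T} hS hT := by
    refine ⟨fun i j h => ?_, hS.2.add hT.2⟩
    rw [add_apply, lp.coeFn_add, Pi.add_apply, hS.1 i j h, hT.1 i j h,
      add_zero]
  zero_mem' := ⟨fun _ _ _ => rfl, isCompactOperator_zero⟩
  mul_mem' {S T} hS hT := ⟨hS.1.mul hT.1, hS.2.comp_clm T⟩
  smul_mem' c T hT := by
    refine ⟨fun i j h => ?_, hT.2.smul c⟩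
    rw [smul_apply, lp.coeFn_smul, Pi.smul_apply, hT.1 i j h, smul_zero]

/-- The matrix algebra `M_n = B(ℂⁿ)`. -/
abbrev Mat (n : ℕ) : Type := EuclideanSpace ℂ (Fin n) →L[ℂ] EuclideanSpace ℂ (Fin n)

/-- The C⋆-algebra `∏_{n ≥ m} M_n` of bounded families of matrices, with pointwise operations and
the supremum norm. -/
def MatProd (m : ℕ) : Type := lp (fun n : {n : ℕ // m ≤ n} => Mat n) ∞

instance (n : ℕ) : NonUnitalCStarAlgebra (Mat n) := CStarAlgebra.toNonUnitalCStarAlgebra _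

instance (m : ℕ) : NonUnitalCStarAlgebra (MatProd m) :=
  inferInstanceAs (NonUnitalCStarAlgebra (lp (fun n : {n : ℕ // m ≤ n} => Mat n) ∞))

/-- The compression `T ↦ V_n^* T V_n` of an operator on `ℓ²(ℕ)` to the first `n` basis vectors. -/
def compress (n : ℕ) (T : Ell2 →L[ℂ] Ell2) : Mat n :=
  (ContinuousLinearMap.adjoint (V n).toContinuousLinearMap) ∘L T ∘L (V n).toContinuousLinearMap

theorem norm_compress_le (n : ℕ) (T : Ell2 →L[ℂ] Ell2) : ‖compress n T‖ ≤ ‖T‖ := by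
  have h1 : ‖(V n).toContinuousLinearMap‖ ≤ 1 := (V n).norm_toContinuousLinearMap_le
  have h2 : ‖ContinuousLinearMap.adjoint (V n).toContinuousLinearMap‖ ≤ 1 := by
    rwa [LinearIsometryEquiv.norm_map]
  calc ‖compress n T‖ ≤ ‖ContinuousLinearMap.adjoint (V n).toContinuousLinearMap‖ *
        (‖T‖ * ‖(V n).toContinuousLinearMap‖) :=
        (ContinuousLinearMap.opNorm_comp_le _ _).trans
          (mul_le_mul_of_nonneg_left (ContinuousLinearMap.opNorm_comp_le _ _) (norm_nonneg _))
    _ ≤ 1 * (‖T‖ * 1) := by gcongr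
    _ = ‖T‖ := by ring

theorem compress_zero (n : ℕ) : compress n 0 = 0 := by
  simp [compress]

theorem compress_add (n : ℕ) (S T : Ell2 →L[ℂ] Ell2) :
    compress n (S + T) = compress n S + compress n T := by
  simp [compress]

theorem compress_smul (n : ℕ) (c : ℂ) (T : Ell2 →L[ℂ] Ell2) :
    compress n (c • T) = c • compress n T := by
  simp [compress]

theorem compress_mul (n : ℕ) (S : Ell2 →L[ℂ] Ell2) {T : Ell2 →L[ℂ] Ell2}
    (hT : IsUpperTriangular T) : compress n (S * T) = compress n S * compress n T := by
  ext1 x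
  obtain ⟨z, hz⟩ := hT.exists_V n x
  have hV : ContinuousLinearMap.adjoint (V n).toContinuousLinearMap (V n z) = z := by
    refine ext_inner_right ℂ fun w => ?_
    rw [ContinuousLinearMap.adjoint_inner_left]
    exact (V n).inner_map_map z w
  simp only [compress, mul_apply_eq_comp, ContinuousLinearMap.comp_apply,
    LinearIsometry.coe_toContinuousLinearMap, hz, hV]

theorem memℓp_compress (m : ℕ) (T : Ell2 →L[ℂ] Ell2) :
    Memℓp (fun n : {n : ℕ // m ≤ n} => compress n T) ∞ :=
  memℓp_infty ⟨‖T‖, by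
    rintro _ ⟨n, rfl⟩
    exact norm_compress_le n T⟩

/-- The homomorphism `⊕_{n ≥ m} ρ_n` from the upper triangular compact operators to
`∏_{n ≥ m} M_n`, where `ρ_n(T) = V_n^* T V_n`. -/
def compressionSum (m : ℕ) : triCompact →ₙₐ[ℂ] MatProd m where
  toFun T := (⟨fun n => compress n T, memℓp_compress m T⟩ :
    lp (fun n : {n : ℕ // m ≤ n} => Mat n) ∞)
  map_smul' c T := Subtype.ext (funext fun n => compress_smul n c T)
  map_zero' := Subtype.ext (funext fun n => compress_zero n)
  map_add' S T := Subtype.ext (funext fun n => compress_add n S T)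
  map_mul' S T := Subtype.ext (funext fun n => compress_mul n S T.2.1)

end OperatorAlgebra

end

/-! The compact operators form the C⋆-envelope of the triangular algebra: every C⋆-cover `B` has a
morphism onto `K(ℓ²)`, constructed in `exists_hom_extending_inclusion`. Choose a unit vector `c`
with no zero coordinate, and represent `B` on a Hilbert space where the adjoint of the image of the
rank one operator `e_0 ⊗ c*` attains its norm at a unit vector `ξ`. Sending `x` to the adjoint of
the image of `e_0 ⊗ x*`, applied to `ξ`, is a contraction `U` on `ℓ²` that is norm-preserving at
`c`. Since `U*U` commutes with the diagonal matrix units and `c` has full support, `U` is an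
isometry. Its range reduces the representation, and compressing to it gives the morphism. Thus `[K,
id]` is below all covers.

It is the greatest lower bound of the covers `R_m` because of the structure of `R_0`: modulo
families with norms tending to zero, each of its elements is the family of compressions of a compact
operator (`sub_compressionFamily_mem`). Compatible morphisms out of all the `R_m` kill such null
families, as only tails matter, so they factor through `K` (`exists_hom_of_compatible`). This one
factorization gives both the inductive limit and the meet. As the `R_m` are RFD, the meet of all RFD
covers is the same.

A least RFD cover would equal this meet, but `K` has no nonzero finite-dimensional representation
and so is not RFD. -/

noncomputable section

namespace OperatorAlgebra

open Filter Topology InnerProductSpace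

/-! ### Contractions of Hilbert spaces -/

section Contractions

variable {H K : Type*} [NormedAddCommGroup H] [InnerProductSpace ℂ H] [CompleteSpace H]
  [NormedAddCommGroup K] [InnerProductSpace ℂ K] [CompleteSpace K]

/-- If a contraction does not decrease the norm of a vector, then its adjoint maps the image of
the vector back to it. -/
theorem adjoint_apply_of_contraction (S : H →L[ℂ] K) (hS : ‖S‖ ≤ 1) (y : H) (h : ‖y‖ ≤ ‖S y‖) :
    ContinuousLinearMap.adjoint S (S y) = y := by
  have h1 : ‖ContinuousLinearMap.adjoint S (S y)‖ ≤ ‖S y‖ := by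
    calc _ ≤ ‖ContinuousLinearMap.adjoint S‖ * ‖S y‖ := ContinuousLinearMap.le_opNorm _ _
      _ ≤ 1 * ‖S y‖ := by
        gcongr
        rwa [LinearIsometryEquiv.norm_map]
      _ = _ := one_mul _
  -- Expanding the square gives `‖S*Sy‖² - 2‖Sy‖² + ‖y‖²`, which is at most `‖y‖² - ‖Sy‖² ≤ 0`.
  have h2 := norm_sub_sq (𝕜 := ℂ) (ContinuousLinearMap.adjoint S (S y)) y
  rw [ContinuousLinearMap.adjoint_inner_left, inner_self_eq_norm_sq] at h2
  have h3 := norm_nonneg (ContinuousLinearMap.adjoint S (S y))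
  have h4 := norm_nonneg y
  have h5 : ‖ContinuousLinearMap.adjoint S (S y) - y‖ ^ 2 ≤ 0 := by nlinarith
  rw [← sub_eq_zero, ← norm_eq_zero]
  exact pow_eq_zero_iff two_ne_zero |>.1 (le_antisymm h5 (by positivity))

/-- On its range `p` preserves norms, so `p*` fixes the range pointwise. Hence `p = p*p`. -/
theorem isSelfAdjoint_of_contraction (p : H →L[ℂ] H) (hp : p * p = p) (h1 : ‖p‖ ≤ 1) :
    IsSelfAdjoint p := by
  have : star p * p = p := by
    ext x
    have hx : p (p x) = p x := congr($hp x)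
    have := adjoint_apply_of_contraction p h1 (p x) (by rw [hx])
    rw [hx] at this
    exact this
  rw [← this]
  exact IsSelfAdjoint.star_mul_self p

end Contractions

/-! ### Matrix units and compact operators on `ℓ²(ℕ)` -/

/-- The matrix unit `E_ij`, which maps `e_j` to `e_i`. -/
def matrixUnit (i j : ℕ) : Ell2 →L[ℂ] Ell2 := rankOne ℂ (e i) (e j)

theorem inner_e (j : ℕ) (x : Ell2) : inner ℂ (e j) x = (x : ℕ → ℂ) j := by
  rw [e, lp.inner_single_left]
  simp

theorem norm_e (j : ℕ) : ‖e j‖ = 1 := orthonormal_e.norm_eq_one j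

theorem matrixUnit_apply (i j : ℕ) (x : Ell2) : matrixUnit i j x = (x : ℕ → ℂ) j • e i := by
  rw [matrixUnit, rankOne_apply, inner_e]

theorem matrixUnit_apply_e (i j k : ℕ) : matrixUnit i j (e k) = if j = k then e i else 0 := by
  rw [matrixUnit_apply, e_apply]
  split_ifs <;> simp

theorem star_matrixUnit (i j : ℕ) : star (matrixUnit i j) = matrixUnit j i :=
  adjoint_rankOne _ _

theorem norm_matrixUnit (i j : ℕ) : ‖matrixUnit i j‖ = 1 := by
  rw [matrixUnit, norm_rankOne, norm_e, norm_e, one_mul]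

theorem matrixUnit_mul (i j k l : ℕ) :
    matrixUnit i j * matrixUnit k l = if j = k then matrixUnit i l else 0 := by
  ext1 x
  rw [mul_apply_eq_comp, matrixUnit_apply k l, map_smul, matrixUnit_apply_e]
  split_ifs
  · rw [matrixUnit_apply]
  · simp

theorem isCompactOperator_rankOne (x y : Ell2) : IsCompactOperator (rankOne ℂ x y) := by
  rw [rankOne_def']
  exact (isCompactOperator_of_locallyCompactSpace_rng
    (ContinuousLinearMap.toSpanSingleton ℂ x)).comp_clm (innerSL ℂ y)

theorem ext_e {T S : Ell2 →L[ℂ] Ell2} (h : ∀ j, T (e j) = S (e j)) : T = S := by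
  ext1 x
  have hx := lp.hasSum_single (p := 2) (by simp) x
  have h1 : ∀ j, lp.single 2 j ((x : ℕ → ℂ) j) = (x : ℕ → ℂ) j • e j := fun j => by
    rw [e, ← lp.single_smul, smul_eq_mul, mul_one]
  simp only [h1] at hx
  refine (hx.mapL T).unique ?_
  have := hx.mapL S
  simpa [h] using this

/-- The projection onto the span of the first `n` basis vectors. -/
def truncation (n : ℕ) : Ell2 →L[ℂ] Ell2 := ∑ i ∈ Finset.range n, matrixUnit i i

theorem truncation_apply_apply (n : ℕ) (x : Ell2) (k : ℕ) :
    (truncation n x : ℕ → ℂ) k = if k < n then (x : ℕ → ℂ) k else 0 := by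
  have : (truncation n x : ℕ → ℂ) k
      = ∑ i ∈ Finset.range n, (x : ℕ → ℂ) i * (if k = i then 1 else 0) := by
    rw [truncation, sum_apply, lp.coeFn_sum, Finset.sum_apply]
    refine Finset.sum_congr rfl fun i _ => ?_
    rw [matrixUnit_apply, lp.coeFn_smul, Pi.smul_apply, e_apply, smul_eq_mul]
  rw [this]
  simp

theorem adjoint_V_apply_V (n : ℕ) (x : EuclideanSpace ℂ (Fin n)) :
    ContinuousLinearMap.adjoint (V n).toContinuousLinearMap
      ((V n).toContinuousLinearMap x) = x := by
  refine ext_inner_right ℂ fun y => ?_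
  rw [ContinuousLinearMap.adjoint_inner_left]
  exact (V n).inner_map_map x y

theorem truncation_eq (n : ℕ) :
    truncation n = (V n).toContinuousLinearMap ∘L
      ContinuousLinearMap.adjoint (V n).toContinuousLinearMap := by
  refine ext_e fun j => ?_
  ext k
  rw [truncation_apply_apply, ContinuousLinearMap.comp_apply,
    LinearIsometry.coe_toContinuousLinearMap, V_apply_apply]
  split_ifs with h
  · have := ContinuousLinearMap.adjoint_inner_right (V n).toContinuousLinearMap
      (EuclideanSpace.single (⟨k, h⟩ : Fin n) (1 : ℂ)) (e j)
    rw [EuclideanSpace.inner_single_left, LinearIsometry.coe_toContinuousLinearMap, V_apply,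
      Finset.sum_eq_single (⟨k, h⟩ : Fin n)] at this
    · simpa [inner_e] using this.symm
    · intro b _ hb
      simp [hb]
    · simp
  · rfl

theorem isSelfAdjoint_truncation (n : ℕ) : IsSelfAdjoint (truncation n) := by
  rw [truncation, IsSelfAdjoint, star_sum]
  simp only [star_matrixUnit]

theorem truncation_mul_self (n : ℕ) : truncation n * truncation n = truncation n := by
  ext1 x
  ext k
  rw [mul_apply_eq_comp, truncation_apply_apply, truncation_apply_apply]
  split_ifs <;> rfl

theorem norm_truncation_le (n : ℕ) : ‖truncation n‖ ≤ 1 := by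
  have h := CStarRing.norm_star_mul_self (x := truncation n)
  rw [(isSelfAdjoint_truncation n).star_eq, truncation_mul_self] at h
  by_contra! h1
  nlinarith

theorem tendsto_truncation_apply (x : Ell2) :
    Tendsto (fun n => truncation n x) atTop (𝓝 x) := by
  have hx := (lp.hasSum_single (p := 2) (by simp) x).tendsto_sum_nat
  refine hx.congr fun n => ?_
  rw [truncation, sum_apply]
  refine Finset.sum_congr rfl fun i _ => ?_
  rw [matrixUnit_apply, e, ← lp.single_smul, smul_eq_mul, mul_one]

/-- Truncation of the range approximates a compact operator in norm. -/
theorem tendsto_truncation_mul {T : Ell2 →L[ℂ] Ell2} (hT : IsCompactOperator T) :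
    Tendsto (fun n => truncation n * T) atTop (𝓝 T) := by
  rw [Metric.tendsto_nhds]
  intro ε hε
  have hK := (hT.isCompact_closure_image_closedBall (𝕜₁ := ℂ) 1).totallyBounded
  -- Strong convergence of the truncations is uniform on a finite net of the image of the unit ball;
  -- contractivity of the truncations handles the distance to the net. The three errors of `ε / 6`
  -- sum to `ε / 2`, which leaves room for the strict inequality after the supremum.
  obtain ⟨t, htf, ht⟩ := Metric.totallyBounded_iff.1 hK (ε / 6) (by positivity)
  have hev : ∀ᶠ n in atTop, ∀ y ∈ t, ‖truncation n y - y‖ < ε / 6 := by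
    rw [eventually_all_finite htf]
    intro y _
    have := Metric.tendsto_nhds.1 (tendsto_truncation_apply y) (ε / 6) (by positivity)
    simpa only [dist_eq_norm] using this
  filter_upwards [hev] with n hn
  rw [dist_eq_norm]
  refine lt_of_le_of_lt (b := ε / 2) ?_ (by linarith)
  refine ContinuousLinearMap.opNorm_le_of_unit_norm (by positivity) fun x hx => ?_
  have hx' : T x ∈ closure (T '' Metric.closedBall 0 1) :=
    subset_closure ⟨x, by simp [hx], rfl⟩
  obtain ⟨y, hy, hxy⟩ := Set.mem_iUnion₂.1 (ht hx')
  rw [Metric.mem_ball, dist_eq_norm] at hxy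
  have h1 : (truncation n * T - T) x =
      truncation n (T x - y) + (truncation n y - y) - (T x - y) := by
    rw [sub_apply, mul_apply_eq_comp, map_sub]
    abel
  have h2 : ‖truncation n (T x - y)‖ ≤ ‖T x - y‖ := by
    simpa using (truncation n).le_of_opNorm_le (norm_truncation_le n) (T x - y)
  rw [h1]
  calc _ ≤ ‖truncation n (T x - y)‖ + ‖truncation n y - y‖ + ‖T x - y‖ :=
        (norm_sub_le _ _).trans (by gcongr; exact norm_add_le _ _)
    _ ≤ ε / 6 + ε / 6 + ε / 6 := by
        have := hn y hy
        linarith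
    _ = ε / 2 := by ring

theorem isCompactOperator_truncation (n : ℕ) : IsCompactOperator (truncation n) := by
  change truncation n ∈ compactOperator (RingHom.id ℂ) Ell2 Ell2
  rw [truncation]
  exact Submodule.sum_mem _ fun i _ => isCompactOperator_rankOne _ _

/-- The adjoints of the truncations `P_n T` are the compact operators `T* P_n`, and they converge in
norm to `T*`. -/
theorem isCompactOperator_star {T : Ell2 →L[ℂ] Ell2} (hT : IsCompactOperator T) :
    IsCompactOperator (star T : Ell2 →L[ℂ] Ell2) := by
  refine isCompactOperator_of_tendsto (l := atTop) (F := fun n => star T * truncation n) ?_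
    (Eventually.of_forall fun n => (isCompactOperator_truncation n).clm_comp (star T))
  have := (tendsto_truncation_mul hT).star
  simpa only [star_mul, (isSelfAdjoint_truncation _).star_eq] using this

theorem tendsto_mul_truncation {T : Ell2 →L[ℂ] Ell2} (hT : IsCompactOperator T) :
    Tendsto (fun n => T * truncation n) atTop (𝓝 T) := by
  have := (tendsto_truncation_mul (isCompactOperator_star hT)).star
  simpa only [star_mul, (isSelfAdjoint_truncation _).star_eq, star_star] using this

theorem tendsto_truncation_mul_truncation {T : Ell2 →L[ℂ] Ell2} (hT : IsCompactOperator T) :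
    Tendsto (fun n => truncation n * T * truncation n) atTop (𝓝 T) := by
  have h0 : Tendsto (fun n => T * truncation n - T) atTop (𝓝 0) := by
    simpa using (tendsto_mul_truncation hT).sub_const T
  have h1 : Tendsto (fun n => truncation n * (T * truncation n - T)) atTop (𝓝 0) := by
    refine squeeze_zero_norm (fun n => ?_) (tendsto_zero_iff_norm_tendsto_zero.1 h0)
    calc _ ≤ ‖truncation n‖ * ‖T * truncation n - T‖ := norm_mul_le _ _
      _ ≤ 1 * _ := by gcongr; exact norm_truncation_le n
      _ = _ := one_mul _
  have h2 := h1.add (tendsto_truncation_mul hT)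
  rw [zero_add] at h2
  refine h2.congr fun n => ?_
  rw [mul_sub, sub_add_cancel, mul_assoc]

theorem truncation_mul_mul_truncation (n : ℕ) (T : Ell2 →L[ℂ] Ell2) :
    truncation n * T * truncation n = ∑ i ∈ Finset.range n, ∑ j ∈ Finset.range n,
      (T (e j) : ℕ → ℂ) i • matrixUnit i j := by
  rw [truncation, Finset.sum_mul, Finset.sum_mul]
  refine Finset.sum_congr rfl fun i _ => ?_
  rw [Finset.mul_sum]
  refine Finset.sum_congr rfl fun j _ => ?_
  ext1 x
  simp only [mul_apply_eq_comp, smul_apply, matrixUnit_apply, map_smul, smul_smul]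
  rw [mul_comm]

/-- A compact operator lies in every closed subspace that contains the matrix units at the places
of its nonzero matrix entries. -/
theorem mem_of_matrixUnit {T : Ell2 →L[ℂ] Ell2} (hT : IsCompactOperator T)
    (S : Submodule ℂ (Ell2 →L[ℂ] Ell2)) (hS : IsClosed (S : Set (Ell2 →L[ℂ] Ell2)))
    (h : ∀ i j, (T (e j) : ℕ → ℂ) i ≠ 0 → matrixUnit i j ∈ S) : T ∈ S := by
  refine hS.mem_of_tendsto (tendsto_truncation_mul_truncation hT)
    (Eventually.of_forall fun n => ?_)
  rw [truncation_mul_mul_truncation]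
  refine Submodule.sum_mem _ fun i _ => Submodule.sum_mem _ fun j _ => ?_
  by_cases h0 : (T (e j) : ℕ → ℂ) i = 0
  · rw [h0, zero_smul]
    exact S.zero_mem
  · exact S.smul_mem _ (h i j h0)

/-- The rank one operators with range spanned by `e_0` are upper triangular. -/
def firstRow (c : Ell2) : triCompact :=
  ⟨rankOne ℂ (e 0) c, fun i j hij => by
    rw [rankOne_apply, lp.coeFn_smul, Pi.smul_apply, e_apply, if_neg (by omega), smul_zero],
    isCompactOperator_rankOne _ _⟩

theorem norm_firstRow (c : Ell2) : ‖firstRow c‖ = ‖c‖ := by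
  change ‖rankOne ℂ (e 0) c‖ = _
  rw [norm_rankOne, norm_e, one_mul]

/-- The first row is a right ideal on which the algebra acts through adjoints. This is the source of
the intertwining relation for adjoints in `exists_intertwiner`. -/
theorem firstRow_mul (c : Ell2) (T : triCompact) :
    firstRow c * T = firstRow (star (T : Ell2 →L[ℂ] Ell2) c) := by
  apply Subtype.ext
  change rankOne ℂ (e 0) c * (T : Ell2 →L[ℂ] Ell2) = rankOne ℂ (e 0) _
  rw [ContinuousLinearMap.mul_def, rankOne_comp]
  rfl

/-- The matrix unit `E_ij`, `i ≤ j`, as an upper triangular compact operator. -/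
def triUnit (i j : ℕ) (h : i ≤ j) : triCompact :=
  ⟨matrixUnit i j, fun k l hkl => by
    rw [matrixUnit_apply_e]
    split_ifs with h1
    · rw [e_apply, if_neg (by omega)]
    · rfl, isCompactOperator_rankOne _ _⟩

theorem triUnit_mul (i j k : ℕ) (hij : i ≤ j) (hjk : j ≤ k) :
    triUnit i j hij * triUnit j k hjk = triUnit i k (hij.trans hjk) :=
  Subtype.ext ((matrixUnit_mul i j j k).trans (if_pos rfl))

theorem norm_triUnit (i j : ℕ) (h : i ≤ j) : ‖triUnit i j h‖ = 1 := norm_matrixUnit i j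

/-- The upper triangular matrix units span a dense subspace of the upper triangular compact
operators. -/
theorem mem_of_triUnit (S : Submodule ℂ triCompact) (hS : IsClosed (S : Set triCompact))
    (h : ∀ i j (hij : i ≤ j), triUnit i j hij ∈ S) (T : triCompact) : T ∈ S := by
  rw [← SetLike.mem_coe, ← hS.closure_eq, closure_subtype]
  refine mem_of_matrixUnit T.2.2
    (S.map triCompact.toSubmodule.subtype).topologicalClosure
    isClosed_closure fun i j h0 => ?_
  have hij : i ≤ j := by
    by_contra! hlt
    exact h0 (T.2.1 i j hlt)
  exact subset_closure ⟨triUnit i j hij, h i j hij, rfl⟩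

/-! ### Norm-attaining representations of C⋆-algebras -/

section States

open scoped ComplexOrder

/-- A contractive unital functional is positive. -/
theorem nonneg_of_contraction {B : Type*} [CStarAlgebra B] [PartialOrder B] [StarOrderedRing B]
    (φ : StrongDual ℂ B) (hφ : ‖φ‖ ≤ 1) (h1 : φ 1 = 1) (a : B) (ha : 0 ≤ a) : 0 ≤ φ a := by
  have hsa : IsSelfAdjoint a := .of_nonneg ha
  -- Evaluate `φ` at `a + it`: its norm squared is at most `‖a‖² + t²` by the C⋆-identity.
  have key : ∀ t : ℝ, ((φ a).im + t) ^ 2 ≤ ‖a‖ ^ 2 + t ^ 2 := by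
    intro t
    set b : B := a + (t * Complex.I) • (1 : B) with hb
    have hφb : φ b = φ a + t * Complex.I := by
      rw [hb, map_add, map_smul, h1, smul_eq_mul, mul_one]
    have hn : ‖φ b‖ ≤ ‖b‖ := by simpa using φ.le_of_opNorm_le hφ b
    have hstar : star b * b = a * a + ((t : ℂ) ^ 2) • (1 : B) := by
      have : star b = a - (t * Complex.I) • (1 : B) := by
        rw [hb, star_add, hsa.star_eq, star_smul, star_one, sub_eq_add_neg, ← neg_smul]
        simp
      rw [this, hb]
      simp only [sub_mul, mul_add, smul_mul_assoc, mul_smul_comm, one_mul, mul_one, smul_sub,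
        smul_smul]
      have h2 : (t * Complex.I) * (t * Complex.I) = -((t : ℂ) ^ 2) := by
        linear_combination ((t : ℂ) ^ 2) * Complex.I_mul_I
      rw [h2, neg_smul]
      abel
    have hnb : ‖b‖ ^ 2 ≤ ‖a‖ ^ 2 + t ^ 2 := by
      rcases subsingleton_or_nontrivial B with hB | hB
      · rw [Subsingleton.elim b 0, norm_zero]
        simp only [ne_eq, OfNat.ofNat_ne_zero, not_false_eq_true, zero_pow]
        positivity
      rw [sq, ← CStarRing.norm_star_mul_self, hstar]
      calc _ ≤ ‖a * a‖ + ‖((t : ℂ) ^ 2) • (1 : B)‖ := norm_add_le _ _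
        _ ≤ ‖a‖ * ‖a‖ + t ^ 2 := by
          gcongr
          · exact norm_mul_le _ _
          · rw [norm_smul, norm_one, mul_one, norm_pow, Complex.norm_real, Real.norm_eq_abs,
              sq_abs]
        _ = _ := by ring
    have him : ((φ a).im + t) ^ 2 ≤ ‖φ b‖ ^ 2 := by
      have h3 : (φ b).im = (φ a).im + t := by
        rw [hφb]
        simp
      rw [← h3, ← sq_abs]
      gcongr
      exact Complex.abs_im_le_norm _
    calc _ ≤ ‖φ b‖ ^ 2 := him
      _ ≤ ‖b‖ ^ 2 := by gcongr
      _ ≤ _ := hnb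
  have him : (φ a).im = 0 := by
    by_contra hne
    -- With this `t` the cross term `2t · Im φ(a)` equals `‖a‖² + 1`, which exceeds the available
    -- `‖a‖²`.
    have h4 := key ((‖a‖ ^ 2 + 1) / (2 * (φ a).im))
    have h5 : 2 * (φ a).im * ((‖a‖ ^ 2 + 1) / (2 * (φ a).im)) = ‖a‖ ^ 2 + 1 := by
      field_simp
    nlinarith [sq_nonneg (φ a).im]
  have hre : 0 ≤ (φ a).re := by
    rcases subsingleton_or_nontrivial B with hB | hB
    · rw [Subsingleton.elim a 0, map_zero, Complex.zero_re]
    -- From `0 ≤ ‖a‖ - a ≤ ‖a‖` the value `φ(a)` is within `‖a‖` of `‖a‖`, so its real part is not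
    -- negative.
    have h6 : ‖(‖a‖ : ℂ) • (1 : B) - a‖ ≤ ‖a‖ := by
      have hle : a ≤ (‖a‖ : ℂ) • (1 : B) := by
        simpa [Algebra.algebraMap_eq_smul_one] using hsa.le_algebraMap_norm_self
      calc _ ≤ ‖(‖a‖ : ℂ) • (1 : B)‖ :=
            CStarAlgebra.norm_le_norm_of_nonneg_of_le (sub_nonneg.2 hle) (sub_le_self _ ha)
        _ = ‖a‖ := by rw [norm_smul, norm_one, mul_one, Complex.norm_real, norm_norm]
    have h7 : ‖φ ((‖a‖ : ℂ) • (1 : B) - a)‖ ≤ ‖a‖ :=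
      ((φ.le_of_opNorm_le hφ _).trans_eq (one_mul _)).trans h6
    rw [map_sub, map_smul, h1, smul_eq_mul, mul_one] at h7
    have h8 := (Complex.re_le_norm _).trans h7
    rw [Complex.sub_re, Complex.ofReal_re] at h8
    linarith
  exact Complex.nonneg_iff.2 ⟨hre, him.symm⟩

/-- A positive element of norm one in a unital C⋆-algebra has a state of value one. -/
theorem exists_state {B : Type*} [CStarAlgebra B] [PartialOrder B] [StarOrderedRing B]
    (a : B) (ha : 0 ≤ a) (h1 : ‖a‖ = 1) : ∃ φ : B →ₚ[ℂ] ℂ, φ 1 = 1 ∧ φ a = 1 := by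
  have hB : Nontrivial B := ⟨a, 0, fun h => by simp [h] at h1⟩
  -- As `1 = ‖a‖` lies in the spectrum of `a`, the norm of `1 + a` is `2`. A functional norming `1 +
  -- a` has `g 1 + g a = 2` with both summands in the unit disc, which forces both to be `1`.
  have hnorm : ‖1 + a‖ = 2 := by
    have hs : (2 : ℝ) ∈ spectrum ℝ (1 + a) := by
      have h2 := CStarAlgebra.norm_mem_spectrum_of_nonneg ha
      rw [h1] at h2
      have := (spectrum.add_mem_add_iff (r := (1 : ℝ)) (s := 1)).2 h2
      rw [map_one] at this
      rwa [one_add_one_eq_two] at this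
    refine le_antisymm ?_ ?_
    · calc _ ≤ ‖(1 : B)‖ + ‖a‖ := norm_add_le _ _
        _ = 2 := by rw [norm_one, h1]; norm_num
    · simpa using spectrum.norm_le_norm_of_mem hs
  obtain ⟨g, hg, hga⟩ := exists_dual_vector'' ℂ (1 + a)
  rw [hnorm, map_add] at hga
  have hb1 : ‖g 1‖ ≤ 1 := by simpa using g.le_of_opNorm_le hg 1
  have hba : ‖g a‖ ≤ 1 := by simpa [h1] using g.le_of_opNorm_le hg a
  have hre1 := (Complex.re_le_norm _).trans hb1
  have hrea := (Complex.re_le_norm _).trans hba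
  have hre := congr_arg Complex.re hga
  replace hre : (g 1).re + (g a).re = 2 := by simpa using hre
  have aux : ∀ z : ℂ, ‖z‖ ≤ 1 → z.re = 1 → z = 1 := by
    intro z hz hz1
    have h2 : z.re ^ 2 + z.im ^ 2 ≤ 1 := by
      have := Complex.sq_norm z
      rw [Complex.normSq_apply] at this
      nlinarith [norm_nonneg z]
    have h3 : z.im = 0 := by
      rw [hz1] at h2
      exact pow_eq_zero_iff two_ne_zero |>.1 (le_antisymm (by linarith) (sq_nonneg _))
    exact Complex.ext hz1 h3
  have hg1 : g 1 = 1 := aux _ hb1 (by linarith)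
  have hga1 : g a = 1 := aux _ hba (by linarith)
  exact ⟨.mk₀ g.toLinearMap (fun b hb => nonneg_of_contraction g hg hg1 b hb), hg1, hga1⟩

/-- A C⋆-algebra has, for each element `x` of norm one, a representation on a Hilbert space in which
the norm of `x⋆` is attained at a unit vector. -/
theorem exists_representation {B : Type u} [NonUnitalCStarAlgebra B] (x : B) (hx : ‖x‖ = 1) :
    ∃ (H : Type u) (_ : NormedAddCommGroup H) (_ : InnerProductSpace ℂ H) (_ : CompleteSpace H)
      (π : B →⋆ₙₐ[ℂ] (H →L[ℂ] H)) (ξ : H), ‖ξ‖ = 1 ∧ ‖star (π x) ξ‖ = 1 := by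
  let _ := CStarAlgebra.spectralOrder (Unitization ℂ B)
  let _ := CStarAlgebra.spectralOrderedRing (Unitization ℂ B)
  set y : Unitization ℂ B := (x : Unitization ℂ B) with hy
  have hyn : ‖y‖ = 1 := by rw [hy, Unitization.norm_inr, hx]
  -- In the GNS space of a state with `φ(y y*) = 1`, the class `ξ` of `1` satisfies `‖π(x)* ξ‖² =
  -- φ(y y*)`.
  obtain ⟨φ, h1, ha⟩ := exists_state (y * star y) (mul_star_self_nonneg y) (by
    rw [CStarRing.norm_self_mul_star, hyn, one_mul])
  refine ⟨φ.GNS, inferInstance, inferInstance, inferInstance,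
    φ.gnsNonUnitalStarAlgHom.comp (Unitization.inrNonUnitalStarAlgHom ℂ B),
    ((φ.toPreGNS 1 : φ.PreGNS) : φ.GNS), ?_, ?_⟩
  · rw [UniformSpace.Completion.norm_coe (E := φ.PreGNS), φ.preGNS_norm_def]
    simp [h1]
  · rw [← map_star]
    change ‖φ.gnsNonUnitalStarAlgHom ((star x : B) : Unitization ℂ B) _‖ = 1
    rw [φ.gnsNonUnitalStarAlgHom_apply_coe, UniformSpace.Completion.norm_coe (E := φ.PreGNS), φ.preGNS_norm_def]
    rw [Unitization.inr_star, ← hy]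
    simp [ha]

end States

/-! ### Homomorphisms out of C⋆-covers -/

section Covers

variable {H : Type w} [NormedAddCommGroup H] [InnerProductSpace ℂ H]
  {A : NonUnitalSubalgebra ℂ (H →L[ℂ] H)}

/-- A closed ⋆-subalgebra that contains the range of `θ` contains `C*(θ(A))`. -/
theorem cstarGenerated_le {B : Type u} [NonUnitalCStarAlgebra B] {θ : A →ₙₐ[ℂ] B}
    {S : NonUnitalStarSubalgebra ℂ B} (hS : IsClosed (S : Set B)) (h : ∀ a, θ a ∈ S) :
    cstarGenerated θ ≤ S :=
  NonUnitalStarSubalgebra.topologicalClosure_minimal _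
    (NonUnitalStarAlgebra.adjoin_le (Set.range_subset_iff.2 h)) hS

variable [CompleteSpace H]

theorem matrixNorm_of_one {B : Type u} [NonUnitalCStarAlgebra B] (b : B) :
    matrixNorm (Matrix.of fun _ _ : Fin 1 => b) = ‖b‖ := by
  let _ := CStarAlgebra.spectralOrder B
  let _ := CStarAlgebra.spectralOrderedRing B
  let f : B →⋆ₙₐ[ℂ] CStarMatrix (Fin 1) (Fin 1) B :=
    { toFun := fun b => CStarMatrix.ofMatrix (Matrix.of fun _ _ => b)
      map_smul' := fun _ _ => rfl
      map_zero' := rfl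
      map_add' := fun _ _ => rfl
      map_mul' := fun a b => by ext; simp [CStarMatrix.mul_apply]
      map_star' := fun _ => rfl }
  have hf : Function.Injective f := fun x y h => congr_fun (congr_fun h 0) 0
  have h : ‖f b‖ = ‖b‖ := NonUnitalStarAlgHom.norm_map f hf b
  exact h

theorem IsCompletelyIsometric.norm_map {B : Type u} [NonUnitalCStarAlgebra B] {θ : A →ₙₐ[ℂ] B}
    (hθ : IsCompletelyIsometric θ) (a : A) : ‖θ a‖ = ‖(a : H →L[ℂ] H)‖ := by
  rw [← matrixNorm_of_one, ← matrixNorm_of_one]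
  exact hθ 1 (Matrix.of fun _ _ => a)

/-- Induction principle for covers: a property that cuts out a closed ⋆-subalgebra need only be
checked on the image of `A`. -/
theorem CStarCover.mem_of_forall_ι_mem (B : CStarCover.{u} A)
    {S : NonUnitalStarSubalgebra ℂ B.carrier} (hS : IsClosed (S : Set B.carrier))
    (h : ∀ a, B.ι a ∈ S) (b : B.carrier) : b ∈ S :=
  cstarGenerated_le hS h (B.generates ▸ NonUnitalStarAlgebra.mem_top)

theorem continuous_starHom {B : Type u} {C : Type v} [NonUnitalCStarAlgebra B]
    [NonUnitalCStarAlgebra C] (σ : B →⋆ₙₐ[ℂ] C) : Continuous σ :=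
  AddMonoidHomClass.continuous_of_bound σ 1 fun b => by
    simpa using NonUnitalStarAlgHom.norm_apply_le σ b

theorem CStarCover.hom_ext (B : CStarCover.{u} A) {C : Type v} [NonUnitalCStarAlgebra C]
    {σ τ : B.carrier →⋆ₙₐ[ℂ] C} (h : ∀ a, σ (B.ι a) = τ (B.ι a)) : σ = τ := by
  refine NonUnitalStarAlgHom.ext fun b => ?_
  exact B.mem_of_forall_ι_mem (S := NonUnitalStarAlgHom.equalizer σ τ)
    (isClosed_eq (continuous_starHom σ) (continuous_starHom τ)) h b

end Covers

/-! ### The ⋆-homomorphism from a C⋆-cover to the compact operators -/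

section Envelope

variable {H : Type u} [NormedAddCommGroup H] [InnerProductSpace ℂ H] [CompleteSpace H]

/-- An isometry that intertwines the adjoints of the upper triangular compact operators with those
of their images under a contractive representation, and the diagonal matrix units with their images,
intertwines the representation with the identity representation. -/
theorem intertwines_of_adjoint (ρ : triCompact →ₙₐ[ℂ] (H →L[ℂ] H)) (hρ : ∀ a, ‖ρ a‖ ≤ ‖a‖)
    (U : Ell2 →L[ℂ] H) (hU1 : ‖U‖ ≤ 1) (hone : ContinuousLinearMap.adjoint U ∘L U = 1)
    (hUstar : ∀ T : triCompact, star (ρ T) ∘L U = U ∘L star (T : Ell2 →L[ℂ] Ell2))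
    (hdiag : ∀ j, ρ (triUnit j j le_rfl) ∘L U = U ∘L matrixUnit j j) (T : triCompact) :
    ρ T ∘L U = U ∘L (T : Ell2 →L[ℂ] Ell2) := by
  have hUn : ∀ x, ‖U x‖ = ‖x‖ := by
    intro x
    have h1 : inner ℂ (U x) (U x) = inner ℂ x x := by
      rw [← ContinuousLinearMap.adjoint_inner_right]
      congr 1
      exact congr($hone x)
    rw [inner_self_eq_norm_sq_to_K, inner_self_eq_norm_sq_to_K] at h1
    have h2 : ‖U x‖ ^ 2 = ‖x‖ ^ 2 := by exact_mod_cast h1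
    exact (sq_eq_sq₀ (norm_nonneg _) (norm_nonneg _)).1 h2
  -- The adjoint of `hUstar` reads `U* ρ(T) = T U*`; multiply by `U` on the right.
  have hadj : ∀ T : triCompact, ContinuousLinearMap.adjoint U ∘L ρ T ∘L U = T := by
    intro T
    have h1 := congr(ContinuousLinearMap.adjoint $(hUstar T))
    rw [ContinuousLinearMap.adjoint_comp, ContinuousLinearMap.adjoint_comp,
      ContinuousLinearMap.star_eq_adjoint, ContinuousLinearMap.star_eq_adjoint,
      ContinuousLinearMap.adjoint_adjoint, ContinuousLinearMap.adjoint_adjoint] at h1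
    rw [← ContinuousLinearMap.comp_assoc, h1, ContinuousLinearMap.comp_assoc, hone]
    exact ContinuousLinearMap.comp_id _
  let S : Submodule ℂ triCompact :=
    { carrier := {T | ρ T ∘L U = U ∘L (T : Ell2 →L[ℂ] Ell2)}
      add_mem' := fun {T T'} h h' => by
        simp only [Set.mem_ofPred_eq] at h h' ⊢
        rw [map_add, ContinuousLinearMap.add_comp, h, h']
        exact (ContinuousLinearMap.comp_add _ _ _).symm
      zero_mem' := by
        simp only [Set.mem_ofPred_eq, map_zero, ContinuousLinearMap.zero_comp]
        exact (ContinuousLinearMap.comp_zero _).symm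
      smul_mem' := fun a T h => by
        simp only [Set.mem_ofPred_eq] at h ⊢
        rw [map_smul, ContinuousLinearMap.smul_comp, h]
        exact (ContinuousLinearMap.comp_smul _ _ _).symm }
  have hρc : Continuous ρ := AddMonoidHomClass.continuous_of_bound ρ 1 fun a => (hρ a).trans_eq (one_mul _).symm
  refine mem_of_triUnit S (isClosed_eq (hρc.clm_comp continuous_const)
    (continuous_const.clm_comp continuous_subtype_val)) (fun i j hij => ?_) T
  change ρ (triUnit i j hij) ∘L U = U ∘L matrixUnit i j
  ext1 x
  have hE : ρ (triUnit i j hij) = ρ (triUnit i j hij) * ρ (triUnit j j le_rfl) := by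
    rw [← map_mul, triUnit_mul]
  -- The vector `ρ(E_ij) U e_j` has norm at most one and `U*` maps it to the unit vector `e_i`. This
  -- is the equality case for the contraction `U*`, so the vector is `U e_i`.
  have hej : ρ (triUnit i j hij) (U (e j)) = U (e i) := by
    have h1 : ContinuousLinearMap.adjoint U (ρ (triUnit i j hij) (U (e j))) = e i := by
      have := congr($(hadj (triUnit i j hij)) (e j))
      refine Eq.trans this ?_
      change matrixUnit i j (e j) = e i
      rw [matrixUnit_apply_e, if_pos rfl]
    have h2 := adjoint_apply_of_contraction (ContinuousLinearMap.adjoint U)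
      (by rwa [LinearIsometryEquiv.norm_map]) (ρ (triUnit i j hij) (U (e j))) (by
        rw [h1, norm_e]
        calc _ ≤ ‖ρ (triUnit i j hij)‖ * ‖U (e j)‖ := ContinuousLinearMap.le_opNorm _ _
          _ ≤ 1 * 1 := by
            gcongr
            · exact (hρ _).trans (norm_triUnit i j hij).le
            · rw [hUn, norm_e]
          _ = 1 := one_mul 1)
    rw [h1, ContinuousLinearMap.adjoint_adjoint] at h2
    exact h2.symm
  rw [hE]
  have h3 : ρ (triUnit j j le_rfl) (U x) = U (matrixUnit j j x) := congr($(hdiag j) x)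
  rw [ContinuousLinearMap.comp_apply, mul_apply_eq_comp, h3, matrixUnit_apply, map_smul, map_smul,
    hej]
  change _ = U (matrixUnit i j x)
  rw [matrixUnit_apply, map_smul]

/-- A representation of the upper triangular compact operators that attains the norm of the adjoint
of a generic first row contains a copy of the identity representation as a direct summand. -/
theorem exists_intertwiner (ρ : triCompact →ₙₐ[ℂ] (H →L[ℂ] H)) (hρ : ∀ a, ‖ρ a‖ ≤ ‖a‖) {ξ : H}
    (hξ : ‖ξ‖ = 1) {c : Ell2} (hc : ∀ j, (c : ℕ → ℂ) j ≠ 0)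
    (hcξ : ‖star (ρ (firstRow c)) ξ‖ = ‖c‖) :
    ∃ U : Ell2 →L[ℂ] H, ContinuousLinearMap.adjoint U ∘L U = 1 ∧
      (∀ T : triCompact, ρ T ∘L U = U ∘L (T : Ell2 →L[ℂ] Ell2)) ∧
      ∀ T : triCompact, star (ρ T) ∘L U = U ∘L star (T : Ell2 →L[ℂ] Ell2) := by
  have hadd : ∀ x y, firstRow (x + y) = firstRow x + firstRow y := fun x y =>
    Subtype.ext (map_add (rankOne ℂ (e 0)) x y)
  have hsmul : ∀ (a : ℂ) x, firstRow (a • x) = star a • firstRow x := fun a x =>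
    Subtype.ext (map_smulₛₗ (rankOne ℂ (e 0)) a x)
  -- Both `x ↦ firstRow x` and the adjoint are conjugate-linear, so their composite is linear.
  let U : Ell2 →L[ℂ] H := LinearMap.mkContinuous
    { toFun := fun x => star (ρ (firstRow x)) ξ
      map_add' := fun x y => by rw [hadd, map_add, star_add, add_apply]
      map_smul' := fun a x => by
        rw [hsmul, map_smul, star_smul, star_star, smul_apply, RingHom.id_apply] } 1
    fun x => by
      calc ‖star (ρ (firstRow x)) ξ‖ ≤ ‖star (ρ (firstRow x))‖ * ‖ξ‖ :=
            ContinuousLinearMap.le_opNorm _ _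
        _ ≤ 1 * ‖x‖ := by
          rw [norm_star, hξ, mul_one, one_mul, ← norm_firstRow]
          exact hρ _
  have hU : ∀ x, U x = star (ρ (firstRow x)) ξ := fun _ => rfl
  have hU1 : ‖U‖ ≤ 1 := LinearMap.mkContinuous_norm_le _ zero_le_one _
  have hUstar : ∀ T : triCompact, star (ρ T) ∘L U = U ∘L star (T : Ell2 →L[ℂ] Ell2) := by
    intro T
    ext1 x
    rw [ContinuousLinearMap.comp_apply, ContinuousLinearMap.comp_apply, hU, hU, ← firstRow_mul,
      map_mul, star_mul, mul_apply_eq_comp]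
  -- The image of `E_jj` is a contractive idempotent, hence self-adjoint, so the relation for
  -- adjoints already is the relation for `E_jj`.
  have hdiag : ∀ j, ρ (triUnit j j le_rfl) ∘L U = U ∘L matrixUnit j j := by
    intro j
    have hsa : IsSelfAdjoint (ρ (triUnit j j le_rfl)) := by
      refine isSelfAdjoint_of_contraction _ ?_ ?_
      · rw [← map_mul, triUnit_mul]
      · exact (hρ _).trans (norm_triUnit j j le_rfl).le
    have := hUstar (triUnit j j le_rfl)
    rw [hsa.star_eq] at this
    rw [this]
    change U ∘L star (matrixUnit j j) = _
    rw [star_matrixUnit]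
  have hcU : ContinuousLinearMap.adjoint U (U c) = c :=
    adjoint_apply_of_contraction U hU1 c (by rw [hU, hcξ])
  have hcomm : ∀ j x, ContinuousLinearMap.adjoint U (U (matrixUnit j j x)) =
      matrixUnit j j (ContinuousLinearMap.adjoint U (U x)) := by
    intro j x
    refine ext_inner_left ℂ fun y => ?_
    have h1 : U (matrixUnit j j x) = star (ρ (triUnit j j le_rfl)) (U x) := by
      have := hUstar (triUnit j j le_rfl)
      have h2 := congr($this x)
      rw [ContinuousLinearMap.comp_apply, ContinuousLinearMap.comp_apply] at h2
      rw [h2]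
      change _ = U (star (matrixUnit j j) x)
      rw [star_matrixUnit]
    have h3 : inner ℂ y (matrixUnit j j (ContinuousLinearMap.adjoint U (U x))) =
        inner ℂ (matrixUnit j j y) (ContinuousLinearMap.adjoint U (U x)) := by
      conv_rhs => rw [← star_matrixUnit j j]
      exact (ContinuousLinearMap.adjoint_inner_left _ _ _).symm
    rw [h3, ContinuousLinearMap.adjoint_inner_right, ContinuousLinearMap.adjoint_inner_right, h1,
      ContinuousLinearMap.star_eq_adjoint, ContinuousLinearMap.adjoint_inner_right]
    congr 1
    exact congr($(hdiag j) y)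
  -- `U*U` fixes `c` and commutes with `E_jj`, so it fixes `c_j e_j`; divide by `c_j ≠ 0`.
  have hUe : ∀ j, ContinuousLinearMap.adjoint U (U (e j)) = e j := by
    intro j
    have h1 := hcomm j c
    rw [hcU, matrixUnit_apply, map_smul, map_smul] at h1
    exact smul_right_injective _ (hc j) h1
  have hone : ContinuousLinearMap.adjoint U ∘L U = 1 := ext_e hUe
  exact ⟨U, hone, intertwines_of_adjoint ρ hρ U hU1 hone hUstar hdiag, hUstar⟩

/-- The normalized geometric sequence `2⁻ʲ`. Full support lets norm attainment at a single vector
control every coordinate. -/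
theorem exists_forall_apply_ne_zero : ∃ c : Ell2, ‖c‖ = 1 ∧ ∀ j, (c : ℕ → ℂ) j ≠ 0 := by
  have hm : Memℓp (fun j : ℕ => ((1 / 2 : ℝ) : ℂ) ^ j) 2 := by
    rw [memℓp_gen_iff (by norm_num)]
    have : Summable fun j : ℕ => (1 / 4 : ℝ) ^ j :=
      summable_geometric_of_lt_one (by norm_num) (by norm_num)
    refine this.congr fun j => ?_
    rw [norm_pow, Complex.norm_real]
    norm_num
    rw [pow_right_comm]
    norm_num
  let v : Ell2 := ⟨_, hm⟩
  have hv : ∀ j, (v : ℕ → ℂ) j ≠ 0 := fun j => pow_ne_zero _ (by norm_num)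
  have hv0 : v ≠ 0 := fun h => hv 0 (by rw [h]; rfl)
  refine ⟨((‖v‖⁻¹ : ℝ) : ℂ) • v, ?_, fun j => ?_⟩
  · rw [norm_smul, Complex.norm_real, norm_inv, norm_norm, inv_mul_cancel₀ (norm_ne_zero_iff.2 hv0)]
  · rw [lp.coeFn_smul, Pi.smul_apply]
    exact smul_ne_zero (by simpa using hv0) (hv j)

/-- Every C⋆-cover of the upper triangular compact operators has a morphism to the bounded operators
that extends the inclusion. -/
theorem exists_hom_extending_inclusion (B : CStarCover.{u} triCompact) :
    ∃ σ : B.carrier →⋆ₙₐ[ℂ] (Ell2 →L[ℂ] Ell2), ∀ a, σ (B.ι a) = a := by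
  obtain ⟨c, hc1, hc⟩ := exists_forall_apply_ne_zero
  have hx : ‖B.ι (firstRow c)‖ = 1 := by
    rw [B.completelyIsometric.norm_map, ← hc1]
    exact norm_firstRow c
  obtain ⟨H, _, _, _, π, ξ, hξ, hπ⟩ := exists_representation _ hx
  obtain ⟨U, hone, h1, h2⟩ := exists_intertwiner ((π : B.carrier →ₙₐ[ℂ] (H →L[ℂ] H)).comp B.ι)
    (fun a => (NonUnitalStarAlgHom.norm_apply_le π _).trans_eq (B.completelyIsometric.norm_map a))
    hξ hc (hπ.trans hc1.symm)
  set Q : H →L[ℂ] H := U ∘L ContinuousLinearMap.adjoint U with hQ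
  have hQsa : star Q = Q := by
    rw [hQ, ContinuousLinearMap.star_eq_adjoint, ContinuousLinearMap.adjoint_comp,
      ContinuousLinearMap.adjoint_adjoint]
  have hQU : Q ∘L U = U := by
    rw [hQ, ContinuousLinearMap.comp_assoc, hone]
    exact ContinuousLinearMap.comp_id _
  -- The relations for `ρ(T)` and for its adjoint together say that the range of `U` reduces the
  -- image of `A`; the commutant of the self-adjoint `Q` is a closed ⋆-algebra, so it reduces the
  -- whole representation.
  have hcomm : ∀ b, Q * π b = π b * Q := by
    intro b
    have := B.mem_of_forall_ι_mem
      (S := (NonUnitalStarSubalgebra.centralizer ℂ {Q}).comap π)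
      ((Set.isClosed_centralizer _).preimage (continuous_starHom π)) (fun a => ?_) b
    · rw [NonUnitalStarSubalgebra.mem_comap, NonUnitalStarSubalgebra.mem_centralizer_iff] at this
      exact (this Q rfl).1
    · have h3 : π (B.ι a) * Q = U ∘L (a : Ell2 →L[ℂ] Ell2) ∘L ContinuousLinearMap.adjoint U := by
        rw [← ContinuousLinearMap.comp_assoc, ← h1 a]
        rfl
      have h4 : Q * π (B.ι a) = U ∘L (a : Ell2 →L[ℂ] Ell2) ∘L ContinuousLinearMap.adjoint U := by
        have h5 : star (π (B.ι a)) * Q = U ∘L star (a : Ell2 →L[ℂ] Ell2) ∘L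
            ContinuousLinearMap.adjoint U := by
          rw [← ContinuousLinearMap.comp_assoc, ← h2 a]
          rfl
        have h6 := congr(star $h5)
        rw [star_mul, star_star, hQsa] at h6
        rw [h6, ContinuousLinearMap.star_eq_adjoint, ContinuousLinearMap.adjoint_comp,
          ContinuousLinearMap.adjoint_comp, ContinuousLinearMap.adjoint_adjoint,
          ContinuousLinearMap.star_eq_adjoint, ContinuousLinearMap.adjoint_adjoint,
          ContinuousLinearMap.comp_assoc]
      rw [NonUnitalStarSubalgebra.mem_comap, NonUnitalStarSubalgebra.mem_centralizer_iff]
      rintro _ rfl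
      rw [hQsa, h3, h4]
      exact ⟨rfl, rfl⟩
  have hπU : ∀ b, π b ∘L U = U ∘L ContinuousLinearMap.adjoint U ∘L π b ∘L U := by
    intro b
    calc π b ∘L U = (π b * Q) ∘L U := by
          rw [ContinuousLinearMap.mul_def, ContinuousLinearMap.comp_assoc, hQU]
      _ = (Q * π b) ∘L U := by rw [hcomm]
      _ = _ := rfl
  refine ⟨
    { toFun := fun b => ContinuousLinearMap.adjoint U ∘L π b ∘L U
      map_smul' := fun a b => by
        rw [map_smul, ContinuousLinearMap.smul_comp, ContinuousLinearMap.comp_smul]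
        rfl
      map_zero' := by rw [map_zero, ContinuousLinearMap.zero_comp, ContinuousLinearMap.comp_zero]
      map_add' := fun a b => by
        rw [map_add, ContinuousLinearMap.add_comp, ContinuousLinearMap.comp_add]
      map_mul' := fun a b => by
        calc _ = ContinuousLinearMap.adjoint U ∘L π a ∘L (π b ∘L U) := by rw [map_mul]; rfl
          _ = ContinuousLinearMap.adjoint U ∘L π a ∘L
              (U ∘L ContinuousLinearMap.adjoint U ∘L π b ∘L U) := by rw [← hπU]
          _ = _ := rfl
      map_star' := fun a => by
        rw [map_star, ContinuousLinearMap.star_eq_adjoint, ContinuousLinearMap.star_eq_adjoint,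
          ContinuousLinearMap.adjoint_comp, ContinuousLinearMap.adjoint_comp,
          ContinuousLinearMap.adjoint_adjoint, ContinuousLinearMap.comp_assoc] }, fun a => ?_⟩
  change ContinuousLinearMap.adjoint U ∘L (π (B.ι a) ∘L U) = a
  have h3 : π (B.ι a) ∘L U = U ∘L (a : Ell2 →L[ℂ] Ell2) := h1 a
  rw [h3, ← ContinuousLinearMap.comp_assoc, hone]
  exact ContinuousLinearMap.id_comp _

end Envelope

/-! ### Matrix norms and compressions -/

section MatrixNorms

theorem matrixNorm_map_le {B : Type u} {C : Type v} [NonUnitalCStarAlgebra B]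
    [NonUnitalCStarAlgebra C] (f : B →⋆ₙₐ[ℂ] C) {k : ℕ} (M : Matrix (Fin k) (Fin k) B) :
    matrixNorm (M.map f) ≤ matrixNorm M := by
  let _ := CStarAlgebra.spectralOrder B
  let _ := CStarAlgebra.spectralOrderedRing B
  let _ := CStarAlgebra.spectralOrder C
  let _ := CStarAlgebra.spectralOrderedRing C
  exact NonUnitalStarAlgHom.norm_apply_le (CStarMatrix.mapₙₐ (n := Fin k) f)
    (CStarMatrix.ofMatrix M)

theorem matrixNorm_nonneg {B : Type u} [NonUnitalCStarAlgebra B] {k : ℕ}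
    (M : Matrix (Fin k) (Fin k) B) : 0 ≤ matrixNorm M := by
  let _ := CStarAlgebra.spectralOrder B
  let _ := CStarAlgebra.spectralOrderedRing B
  exact norm_nonneg (CStarMatrix.ofMatrix M)

theorem matrixNorm_mul_le {B : Type u} [NonUnitalCStarAlgebra B] {k : ℕ}
    (M N : Matrix (Fin k) (Fin k) B) : matrixNorm (M * N) ≤ matrixNorm M * matrixNorm N := by
  let _ := CStarAlgebra.spectralOrder B
  let _ := CStarAlgebra.spectralOrderedRing B
  exact norm_mul_le (CStarMatrix.ofMatrix M) (CStarMatrix.ofMatrix N)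

theorem matrixNorm_conjTranspose_mul_self {B : Type u} [NonUnitalCStarAlgebra B] {k : ℕ}
    (M : Matrix (Fin k) (Fin k) B) :
    matrixNorm (M.conjTranspose * M) = matrixNorm M * matrixNorm M := by
  let _ := CStarAlgebra.spectralOrder B
  let _ := CStarAlgebra.spectralOrderedRing B
  exact CStarRing.norm_star_mul_self (x := CStarMatrix.ofMatrix M)

/-- The C⋆-norm on matrices of fixed size induces the topology of entrywise convergence. -/
theorem matrixNorm_le_of_tendsto {B : Type u} [NonUnitalCStarAlgebra B] {k : ℕ}
    {F : ℕ → Matrix (Fin k) (Fin k) B} {M : Matrix (Fin k) (Fin k) B}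
    (hF : ∀ i j, Tendsto (fun n => F n i j) atTop (𝓝 (M i j))) {c : ℝ}
    (h : ∀ᶠ n in atTop, matrixNorm (F n) ≤ c) : matrixNorm M ≤ c := by
  let _ := CStarAlgebra.spectralOrder B
  let _ := CStarAlgebra.spectralOrderedRing B
  have ht : Tendsto (fun n => CStarMatrix.ofMatrix (F n)) atTop (𝓝 (CStarMatrix.ofMatrix M)) :=
    tendsto_pi_nhds.2 fun i => tendsto_pi_nhds.2 fun j => hF i j
  exact le_of_tendsto ht.norm h

/-- The diagonal matrix is a projection, so the C⋆-identity makes its norm `t` satisfy `t = t²`. -/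
theorem matrixNorm_diagonal_le {B : Type u} [NonUnitalCStarAlgebra B] {p : B}
    (hp : IsSelfAdjoint p) (hp2 : p * p = p) (k : ℕ) :
    matrixNorm (Matrix.diagonal fun _ : Fin k => p) ≤ 1 := by
  have h := matrixNorm_conjTranspose_mul_self (Matrix.diagonal fun _ : Fin k => p)
  have h1 : (Matrix.diagonal fun _ : Fin k => p).conjTranspose = Matrix.diagonal fun _ => p := by
    rw [Matrix.diagonal_conjTranspose]
    congr 1
    funext i
    exact hp.star_eq
  rw [h1, Matrix.diagonal_mul_diagonal] at h
  simp only [hp2] at h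
  by_contra! h2
  nlinarith

/-- Compressing the entries of a matrix by a projection does not increase its norm. -/
theorem matrixNorm_map_conj_le {B : Type u} [NonUnitalCStarAlgebra B] {p : B}
    (hp : IsSelfAdjoint p) (hp2 : p * p = p) {k : ℕ} (M : Matrix (Fin k) (Fin k) B) :
    matrixNorm (M.map fun b => p * b * p) ≤ matrixNorm M := by
  have hD := matrixNorm_diagonal_le hp hp2 k
  set D : Matrix (Fin k) (Fin k) B := Matrix.diagonal fun _ => p
  have h : (M.map fun b => p * b * p) = D * M * D := by
    ext1 i j
    rw [Matrix.mul_diagonal, Matrix.diagonal_mul, Matrix.map_apply]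
  rw [h]
  calc _ ≤ matrixNorm D * matrixNorm M * matrixNorm D :=
        (matrixNorm_mul_le _ _).trans
          (mul_le_mul_of_nonneg_right (matrixNorm_mul_le _ _) (matrixNorm_nonneg _))
    _ ≤ 1 * matrixNorm M * 1 := by
        have := matrixNorm_nonneg M
        have := matrixNorm_nonneg D
        gcongr
    _ = _ := by ring

/-- The coordinate projections of `∏_{n ≥ m} M_n`. -/
def MatProd.eval (m : ℕ) (n : {n : ℕ // m ≤ n}) : MatProd m →⋆ₙₐ[ℂ] Mat n where
  toFun f := (show lp (fun n : {n : ℕ // m ≤ n} => Mat n) ∞ from f) n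
  map_smul' _ _ := rfl
  map_zero' := rfl
  map_add' _ _ := rfl
  map_mul' _ _ := rfl
  map_star' _ := rfl

theorem MatProd.ext {m : ℕ} {f g : MatProd m} (h : ∀ n, MatProd.eval m n f = MatProd.eval m n g) :
    f = g :=
  lp.ext (funext h)

theorem MatProd.norm_le {m : ℕ} {f : MatProd m} {c : ℝ} (hc : 0 ≤ c)
    (h : ∀ n, ‖MatProd.eval m n f‖ ≤ c) : ‖f‖ ≤ c :=
  lp.norm_le_of_forall_le (E := fun n : {n : ℕ // m ≤ n} => Mat n) hc h

/-- The C⋆-algebra `M_k(B)`. -/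
def MatrixAlg (k : ℕ) (B : Type u) : Type u := CStarMatrix (Fin k) (Fin k) B

instance (k : ℕ) (B : Type u) [NonUnitalCStarAlgebra B] :
    NonUnitalCStarAlgebra (MatrixAlg k B) :=
  letI := CStarAlgebra.spectralOrder B
  letI := CStarAlgebra.spectralOrderedRing B
  inferInstanceAs (NonUnitalCStarAlgebra (CStarMatrix (Fin k) (Fin k) B))

/-- A ⋆-homomorphism applied to the entries of a matrix. -/
def MatrixAlg.map (k : ℕ) {B : Type u} {C : Type v} [NonUnitalCStarAlgebra B]
    [NonUnitalCStarAlgebra C] (f : B →⋆ₙₐ[ℂ] C) : MatrixAlg k B →⋆ₙₐ[ℂ] MatrixAlg k C :=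
  letI := CStarAlgebra.spectralOrder B
  letI := CStarAlgebra.spectralOrderedRing B
  letI := CStarAlgebra.spectralOrder C
  letI := CStarAlgebra.spectralOrderedRing C
  (CStarMatrix.mapₙₐ (n := Fin k) f :)

/-- The norm on matrices over `∏_{n ≥ m} M_n` is the supremum of the norms of the coordinates. -/
theorem MatProd.matrixNorm_le {m k : ℕ} (M : Matrix (Fin k) (Fin k) (MatProd m)) {c : ℝ}
    (hc : 0 ≤ c) (h : ∀ n, matrixNorm (M.map (MatProd.eval m n)) ≤ c) : matrixNorm M ≤ c := by
  -- `M_k(∏ M_n)` embeds in `∏ M_k(M_n)` by an injective ⋆-homomorphism, which is automatically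
  -- isometric.
  let F : MatrixAlg k (MatProd m) →⋆ₙₐ[ℂ]
      lp (fun n : {n : ℕ // m ≤ n} => MatrixAlg k (Mat n)) ∞ :=
    { toFun := fun X => ⟨fun n => MatrixAlg.map k (MatProd.eval m n) X, memℓp_infty ⟨‖X‖, by
        rintro _ ⟨n, rfl⟩
        exact NonUnitalStarAlgHom.norm_apply_le (MatrixAlg.map k (MatProd.eval m n)) X⟩⟩
      map_smul' := fun a X => lp.ext (funext fun n => map_smul _ a X)
      map_zero' := lp.ext (funext fun n => map_zero _)
      map_add' := fun X Y => lp.ext (funext fun n => map_add _ X Y)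
      map_mul' := fun X Y => lp.ext (funext fun n => map_mul _ X Y)
      map_star' := fun X => lp.ext (funext fun n => map_star _ X) }
  have hF : Function.Injective F := by
    intro X Y hXY
    refine CStarMatrix.ext fun i j => MatProd.ext fun n => ?_
    have h1 : MatrixAlg.map k (MatProd.eval m n) X = MatrixAlg.map k (MatProd.eval m n) Y :=
      congr_fun (congr_arg Subtype.val hXY) n
    exact congr_fun (congr_fun h1 i) j
  have h1 : ‖F M‖ = ‖(show MatrixAlg k (MatProd m) from M)‖ := NonUnitalStarAlgHom.norm_map F hF _
  change ‖(show MatrixAlg k (MatProd m) from M)‖ ≤ c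
  rw [← h1]
  exact lp.norm_le_of_forall_le hc h

/-- The embedding `S ↦ V_n S V_n^*` of `M_n` into the operators on `ℓ²(ℕ)`. -/
def inflate (n : ℕ) : Mat n →⋆ₙₐ[ℂ] (Ell2 →L[ℂ] Ell2) where
  toFun S := (V n).toContinuousLinearMap ∘L S ∘L
    ContinuousLinearMap.adjoint (V n).toContinuousLinearMap
  map_smul' a S := by
    rw [ContinuousLinearMap.smul_comp, ContinuousLinearMap.comp_smul]
    rfl
  map_zero' := by rw [ContinuousLinearMap.zero_comp, ContinuousLinearMap.comp_zero]
  map_add' S T := by rw [ContinuousLinearMap.add_comp, ContinuousLinearMap.comp_add]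
  map_mul' S T := by
    ext1 x
    simp only [mul_apply_eq_comp, ContinuousLinearMap.comp_apply]
    rw [adjoint_V_apply_V]
  map_star' S := by
    rw [ContinuousLinearMap.star_eq_adjoint, ContinuousLinearMap.star_eq_adjoint,
      ContinuousLinearMap.adjoint_comp, ContinuousLinearMap.adjoint_comp,
      ContinuousLinearMap.adjoint_adjoint, ContinuousLinearMap.comp_assoc]

theorem inflate_injective (n : ℕ) : Function.Injective (inflate n) := by
  intro S T h
  ext1 x
  have h1 : inflate n S ((V n).toContinuousLinearMap x) =
      inflate n T ((V n).toContinuousLinearMap x) := by rw [h]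
  simp only [inflate, NonUnitalStarAlgHom.coe_mk', NonUnitalAlgHom.coe_mk,
    ContinuousLinearMap.comp_apply] at h1
  have h2 := (V n).injective h1
  rwa [adjoint_V_apply_V] at h2

theorem inflate_compress (n : ℕ) (T : Ell2 →L[ℂ] Ell2) :
    inflate n (compress n T) = truncation n * T * truncation n := by
  rw [truncation_eq]
  rfl

theorem matrixNorm_map_compress (n : ℕ) {k : ℕ} (M : Matrix (Fin k) (Fin k) (Ell2 →L[ℂ] Ell2)) :
    matrixNorm (M.map (compress n)) =
      matrixNorm (M.map fun T => truncation n * T * truncation n) := by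
  rw [← matrixNorm_map (inflate n) (inflate_injective n)]
  congr 1
  ext1 i j
  exact inflate_compress n _

theorem matrixNorm_map_compress_le (n : ℕ) {k : ℕ}
    (M : Matrix (Fin k) (Fin k) (Ell2 →L[ℂ] Ell2)) :
    matrixNorm (M.map (compress n)) ≤ matrixNorm M :=
  (matrixNorm_map_compress n M).trans_le
    (matrixNorm_map_conj_le (isSelfAdjoint_truncation n) (truncation_mul_self n) M)

/-- Compressions do not increase matrix norms, and for compact entries `P_n T P_n → T` in norm. The
limit sees only large `n`, so discarding those below `m` costs nothing. -/
theorem isCompletelyIsometric_compressionSum (m : ℕ) :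
    IsCompletelyIsometric (compressionSum m) := by
  intro k M
  set N : Matrix (Fin k) (Fin k) (Ell2 →L[ℂ] Ell2) := M.map fun a => (a : Ell2 →L[ℂ] Ell2)
  have hN : ∀ n, (M.map (compressionSum m)).map (MatProd.eval m n) = N.map (compress n) :=
    fun n => rfl
  refine le_antisymm ?_ ?_
  · refine MatProd.matrixNorm_le _ (matrixNorm_nonneg N) fun n => ?_
    rw [hN]
    exact matrixNorm_map_compress_le n N
  · refine matrixNorm_le_of_tendsto (F := fun n => N.map fun T => truncation n * T * truncation n)
      (fun i j => tendsto_truncation_mul_truncation (M i j).2.2) ?_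
    filter_upwards [eventually_ge_atTop m] with n hn
    rw [← matrixNorm_map_compress, ← hN ⟨n, hn⟩]
    exact matrixNorm_map_le _ _

/-- The coordinate projections of the product already separate points. -/
theorem isRFD_cstarGenerated_compressionSum (m : ℕ) : IsRFD (cstarGenerated (compressionSum m)) := by
  intro b hb
  obtain ⟨n, hn⟩ : ∃ n, MatProd.eval m n b ≠ 0 := by
    by_contra! h
    exact hb (Subtype.ext (MatProd.ext fun n => (h n).trans (map_zero _).symm))
  let τ : Mat n →⋆ₙₐ[ℂ] Matrix (Fin n) (Fin n) ℂ :=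
    { toFun := (Matrix.toEuclideanCLM (n := Fin n) (𝕜 := ℂ)).symm
      map_smul' := fun a x => map_smul (Matrix.toEuclideanCLM (n := Fin n) (𝕜 := ℂ)).symm a x
      map_zero' := map_zero _
      map_add' := map_add _
      map_mul' := map_mul _
      map_star' := (Matrix.toEuclideanCLM (n := Fin n) (𝕜 := ℂ)).symm.map_star' }
  refine ⟨n, (τ.comp (MatProd.eval m n)).comp
    (NonUnitalStarSubalgebraClass.subtype (cstarGenerated (compressionSum m))), fun h => hn ?_⟩
  exact (Matrix.toEuclideanCLM (n := Fin n) (𝕜 := ℂ)).symm.injective (h.trans (map_zero τ).symm)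

end MatrixNorms

/-! ### The compact operators as a C⋆-cover and as an inductive limit -/

section Compact

/-- The C⋆-algebra of compact operators on `ℓ²(ℕ)`. -/
def compactAlgebra : NonUnitalStarSubalgebra ℂ (Ell2 →L[ℂ] Ell2) where
  carrier := {T | IsCompactOperator T}
  add_mem' hS hT := hS.add hT
  zero_mem' := isCompactOperator_zero
  mul_mem' {_ T} hS _ := hS.comp_clm T
  smul_mem' c _ hT := hT.smul c
  star_mem' hT := isCompactOperator_star hT

theorem isClosed_compactAlgebra : IsClosed (compactAlgebra : Set (Ell2 →L[ℂ] Ell2)) :=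
  isClosed_setOfPred_isCompactOperator

theorem cstarGenerated_subtype_le :
    cstarGenerated (NonUnitalSubalgebraClass.subtype triCompact) ≤ compactAlgebra :=
  cstarGenerated_le isClosed_compactAlgebra fun a => a.2.2

/-- A compact operator lies in every closed ⋆-invariant subspace that contains the upper triangular
compact operators. -/
theorem mem_of_star_mem {T : Ell2 →L[ℂ] Ell2} (hT : IsCompactOperator T)
    (S : Submodule ℂ (Ell2 →L[ℂ] Ell2)) (hS : IsClosed (S : Set (Ell2 →L[ℂ] Ell2)))
    (h : ∀ a : triCompact, (a : Ell2 →L[ℂ] Ell2) ∈ S)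
    (h' : ∀ a : triCompact, star (a : Ell2 →L[ℂ] Ell2) ∈ S) : T ∈ S := by
  refine mem_of_matrixUnit hT S hS fun i j _ => ?_
  rcases le_total i j with hij | hij
  · exact h (triUnit i j hij)
  · rw [← star_matrixUnit]
    exact h' (triUnit j i hij)

theorem mem_cstarGenerated_subtype {T : Ell2 →L[ℂ] Ell2} (hT : IsCompactOperator T) :
    T ∈ cstarGenerated (NonUnitalSubalgebraClass.subtype triCompact) :=
  mem_of_star_mem hT (cstarGenerated (NonUnitalSubalgebraClass.subtype triCompact)).toSubmodule
    (isClosed_cstarGenerated _) (mem_cstarGenerated _)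
    fun a => (cstarGenerated (NonUnitalSubalgebraClass.subtype triCompact)).star_mem'
      (mem_cstarGenerated (NonUnitalSubalgebraClass.subtype triCompact) a)

/-- The cover by the compact operators lies below every C⋆-cover. -/
theorem exists_hom_inclusionCover (B : CStarCover.{u} triCompact) :
    ∃ ψ : B.carrier →⋆ₙₐ[ℂ] (inclusionCover triCompact).carrier,
      ∀ a, ψ (B.ι a) = (inclusionCover triCompact).ι a := by
  obtain ⟨σ, hσ⟩ := exists_hom_extending_inclusion B
  have hmem : ∀ b, σ b ∈ cstarGenerated (NonUnitalSubalgebraClass.subtype triCompact) :=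
    B.mem_of_forall_ι_mem
      (S := (cstarGenerated (NonUnitalSubalgebraClass.subtype triCompact)).comap σ)
      ((isClosed_cstarGenerated _).preimage (continuous_starHom σ)) fun a => by
        rw [NonUnitalStarSubalgebra.mem_comap, hσ]
        exact mem_cstarGenerated (NonUnitalSubalgebraClass.subtype triCompact) a
  exact ⟨NonUnitalStarAlgHom.codRestrict σ _ hmem, fun a => Subtype.ext (hσ a)⟩

end Compact

/-! ### Compressions modulo the families that vanish at infinity. -/

section InductiveLimit

/-- The C⋆-cover generated by the compressions to the first `n` basis vectors, `n ≥ m`. -/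
abbrev compressionCover (m : ℕ) : CStarCover.{0} triCompact :=
  .ofHom (compressionSum m) (isCompletelyIsometric_compressionSum m)

theorem compress_star (n : ℕ) (T : Ell2 →L[ℂ] Ell2) : compress n (star T) = star (compress n T) := by
  rw [compress, compress, ContinuousLinearMap.star_eq_adjoint, ContinuousLinearMap.star_eq_adjoint,
    ContinuousLinearMap.adjoint_comp, ContinuousLinearMap.adjoint_comp,
    ContinuousLinearMap.adjoint_adjoint, ContinuousLinearMap.comp_assoc]

theorem compress_mul_compress (n : ℕ) (S T : Ell2 →L[ℂ] Ell2) :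
    compress n S * compress n T = compress n (S * (truncation n * T)) := by
  rw [truncation_eq]
  rfl

theorem V_single {n j : ℕ} (hj : j < n) :
    (V n).toContinuousLinearMap (EuclideanSpace.single (⟨j, hj⟩ : Fin n) 1) = e j := by
  rw [LinearIsometry.coe_toContinuousLinearMap, V_apply, Finset.sum_eq_single (⟨j, hj⟩ : Fin n)]
  · simp
  · intro b _ hb
    simp [hb]
  · simp

theorem norm_entry_le_norm_compress {n i j : ℕ} (hi : i < n) (hj : j < n)
    (T : Ell2 →L[ℂ] Ell2) : ‖(T (e j) : ℕ → ℂ) i‖ ≤ ‖compress n T‖ := by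
  have h : (T (e j) : ℕ → ℂ) i = inner ℂ (EuclideanSpace.single (⟨i, hi⟩ : Fin n) (1 : ℂ))
      (compress n T (EuclideanSpace.single (⟨j, hj⟩ : Fin n) 1)) := by
    rw [compress, ContinuousLinearMap.comp_apply, ContinuousLinearMap.comp_apply,
      ContinuousLinearMap.adjoint_inner_right, V_single, V_single, inner_e]
  rw [h]
  refine (norm_inner_le_norm _ _).trans ?_
  rw [PiLp.norm_single, norm_one, one_mul]
  refine ((compress n T).le_opNorm _).trans ?_
  rw [PiLp.norm_single, norm_one, mul_one]

/-- The compressions of an arbitrary operator on `ℓ²(ℕ)`, as a linear map to `∏_n M_n`. -/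
def compressionFamily : (Ell2 →L[ℂ] Ell2) →ₗ[ℂ] MatProd 0 where
  toFun T := (⟨fun n => compress n T, memℓp_compress 0 T⟩ :
    lp (fun n : {n : ℕ // 0 ≤ n} => Mat n) ∞)
  map_add' S T := Subtype.ext (funext fun n => compress_add n S T)
  map_smul' c T := Subtype.ext (funext fun n => compress_smul n c T)

theorem eval_compressionFamily (n : {n : ℕ // 0 ≤ n}) (T : Ell2 →L[ℂ] Ell2) :
    MatProd.eval 0 n (compressionFamily T) = compress n T := rfl

theorem compressionFamily_star (T : Ell2 →L[ℂ] Ell2) :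
    compressionFamily (star T) = star (compressionFamily T) := by
  refine MatProd.ext fun n => ?_
  rw [map_star (MatProd.eval 0 n), eval_compressionFamily, eval_compressionFamily, compress_star]

theorem continuous_compressionFamily : Continuous compressionFamily :=
  AddMonoidHomClass.continuous_of_bound compressionFamily 1 fun T => by
    rw [one_mul]
    exact MatProd.norm_le (norm_nonneg T) fun n => norm_compress_le n T

theorem compressionFamily_coe (a : triCompact) :
    compressionFamily (a : Ell2 →L[ℂ] Ell2) = compressionSum 0 a := rfl

/-- Compression is not multiplicative on `K`, but it is linear, continuous and ⋆-preserving, and `K`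
is the closed span of the triangular operators and their adjoints. -/
theorem compressionFamily_mem {T : Ell2 →L[ℂ] Ell2} (hT : IsCompactOperator T) :
    compressionFamily T ∈ cstarGenerated (compressionSum 0) := by
  refine mem_of_star_mem hT
    ((cstarGenerated (compressionSum 0)).toSubmodule.comap compressionFamily)
    ((isClosed_cstarGenerated _).preimage continuous_compressionFamily)
    (mem_cstarGenerated (compressionSum 0)) fun a => ?_
  change compressionFamily (star (a : Ell2 →L[ℂ] Ell2)) ∈ cstarGenerated (compressionSum 0)
  rw [compressionFamily_star]
  exact star_mem (mem_cstarGenerated (compressionSum 0) a)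

/-- The families in `∏_n M_n` whose norms tend to zero. -/
def vanishing : Submodule ℂ (MatProd 0) where
  carrier := {f | Tendsto (fun n => ‖MatProd.eval 0 ⟨n, n.zero_le⟩ f‖) atTop (𝓝 0)}
  add_mem' {f g} hf hg := by
    refine squeeze_zero (fun n => norm_nonneg _) (fun n => ?_) (by simpa using hf.add hg)
    rw [map_add]
    exact norm_add_le _ _
  zero_mem' := by
    refine tendsto_const_nhds.congr fun n => ?_
    rw [map_zero, norm_zero]
  smul_mem' c f hf := by
    refine squeeze_zero (fun n => norm_nonneg _) (fun n => ?_) (by simpa using hf.const_mul ‖c‖)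
    rw [map_smul]
    exact norm_smul_le _ _

theorem mem_vanishing {f : MatProd 0} :
    f ∈ vanishing ↔ Tendsto (fun n => ‖MatProd.eval 0 ⟨n, n.zero_le⟩ f‖) atTop (𝓝 0) := Iff.rfl

theorem norm_eval_le (f : MatProd 0) (n : {n : ℕ // 0 ≤ n}) : ‖MatProd.eval 0 n f‖ ≤ ‖f‖ :=
  NonUnitalStarAlgHom.norm_apply_le _ f

theorem mul_mem_vanishing_left (f : MatProd 0) {g : MatProd 0} (hg : g ∈ vanishing) :
    f * g ∈ vanishing := by
  refine squeeze_zero (fun n => norm_nonneg _) (fun n => ?_) (by simpa using hg.const_mul ‖f‖)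
  rw [map_mul]
  exact (norm_mul_le _ _).trans (mul_le_mul_of_nonneg_right (norm_eval_le f _) (norm_nonneg _))

theorem star_mem_vanishing {f : MatProd 0} (hf : f ∈ vanishing) : star f ∈ vanishing := by
  refine Tendsto.congr (fun n => ?_) hf
  rw [map_star, norm_star]

theorem mul_mem_vanishing_right {f : MatProd 0} (hf : f ∈ vanishing) (g : MatProd 0) :
    f * g ∈ vanishing := by
  have := star_mem_vanishing (mul_mem_vanishing_left (star g) (star_mem_vanishing hf))
  rwa [star_mul, star_star, star_star] at this

theorem isClosed_vanishing : IsClosed (vanishing : Set (MatProd 0)) := by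
  refine isClosed_of_closure_subset fun f hf => ?_
  refine Metric.tendsto_atTop.2 fun ε hε => ?_
  obtain ⟨g, hg, hfg⟩ := Metric.mem_closure_iff.1 hf (ε / 2) (by positivity)
  obtain ⟨N, hN⟩ := Metric.tendsto_atTop.1 hg (ε / 2) (by positivity)
  refine ⟨N, fun n hn => ?_⟩
  have h1 := hN n hn
  rw [Real.dist_0_eq_abs, abs_norm] at h1 ⊢
  rw [dist_eq_norm] at hfg
  have h2 : MatProd.eval 0 ⟨n, n.zero_le⟩ f =
      MatProd.eval 0 ⟨n, n.zero_le⟩ (f - g) + MatProd.eval 0 ⟨n, n.zero_le⟩ g := by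
    rw [map_sub, sub_add_cancel]
  rw [h2]
  have h3 := norm_eval_le (f - g) ⟨n, n.zero_le⟩
  have h4 := norm_add_le (MatProd.eval 0 ⟨n, n.zero_le⟩ (f - g))
    (MatProd.eval 0 ⟨n, n.zero_le⟩ g)
  linarith

/-- Compression is asymptotically multiplicative on the compact operators. -/
theorem compressionFamily_mul_sub_mem (S : Ell2 →L[ℂ] Ell2) {T : Ell2 →L[ℂ] Ell2}
    (hT : IsCompactOperator T) :
    compressionFamily S * compressionFamily T - compressionFamily (S * T) ∈ vanishing := by
  have h0 : Tendsto (fun n => ‖S‖ * ‖truncation n * T - T‖) atTop (𝓝 0) := by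
    have h1 := (tendsto_truncation_mul hT).sub_const T
    rw [sub_self] at h1
    simpa using h1.norm.const_mul ‖S‖
  refine squeeze_zero (fun n => norm_nonneg _) (fun n => ?_) h0
  -- The multiplicative defect at `n` is the compression of `S (P_n T - T)`.
  have h2 : MatProd.eval 0 ⟨n, n.zero_le⟩
      (compressionFamily S * compressionFamily T - compressionFamily (S * T)) =
      compress n (S * (truncation n * T - T)) := by
    have h3 : S * (truncation n * T) = S * (truncation n * T - T) + S * T := by
      rw [mul_sub, sub_add_cancel]
    rw [map_sub, map_mul, eval_compressionFamily, eval_compressionFamily, eval_compressionFamily,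
      compress_mul_compress, h3, compress_add, add_sub_cancel_right]
  rw [h2]
  exact (norm_compress_le n _).trans (norm_mul_le _ _)

/-- Each matrix entry of `T` is bounded by the norms of all sufficiently large compressions. -/
theorem eq_zero_of_compressionFamily_mem {T : Ell2 →L[ℂ] Ell2}
    (hT : compressionFamily T ∈ vanishing) : T = 0 := by
  refine ext_e fun j => ?_
  ext i
  have h2 : ‖(T (e j) : ℕ → ℂ) i‖ ≤ 0 := by
    refine ge_of_tendsto hT ?_
    filter_upwards [eventually_gt_atTop i, eventually_gt_atTop j] with n hi hj
    exact norm_entry_le_norm_compress hi hj T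
  exact norm_le_zero_iff.1 h2

/-- An element of the first compression cover agrees, asymptotically, with the compressions of its
image in the compact operators. -/
theorem sub_compressionFamily_mem
    (ψ : (compressionCover 0).carrier →⋆ₙₐ[ℂ] (inclusionCover triCompact).carrier)
    (hψ : ∀ a, ψ ((compressionCover 0).ι a) = (inclusionCover triCompact).ι a)
    (b : (compressionCover 0).carrier) :
    b.1 - compressionFamily (ψ b).1 ∈ vanishing := by
  have hc : ∀ b, IsCompactOperator (ψ b).1 := fun b => cstarGenerated_subtype_le (ψ b).2
  let S : NonUnitalStarSubalgebra ℂ (compressionCover 0).carrier :=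
    { carrier := {b | b.1 - compressionFamily (ψ b).1 ∈ vanishing}
      add_mem' := fun {b c} hb hc => by
        have h := vanishing.add_mem hb hc
        have h1 : (b.1 + c.1) - compressionFamily ((ψ b).1 + (ψ c).1) ∈ vanishing := by
          rw [map_add]
          convert h using 1
          abel
        rwa [Set.mem_ofPred_eq, map_add]
      zero_mem' := by
        rw [Set.mem_ofPred_eq, map_zero]
        have h1 : (0 : MatProd 0) - compressionFamily 0 ∈ vanishing := by
          rw [map_zero, sub_zero]
          exact vanishing.zero_mem
        exact h1
      mul_mem' := fun {b c} hb hc' => by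
        rw [Set.mem_ofPred_eq, map_mul]
        -- With `F` the compression family, `bc - F(ψb ψc)` is the sum of `(b - Fψb) c`, `Fψb (c -
        -- Fψc)` and the multiplicative defect of `F`.
        have h := vanishing.add_mem (vanishing.add_mem (mul_mem_vanishing_right hb c.1)
          (mul_mem_vanishing_left (compressionFamily (ψ b).1) hc'))
          (compressionFamily_mul_sub_mem (ψ b).1 (hc c))
        have h1 : b.1 * c.1 - compressionFamily ((ψ b).1 * (ψ c).1) ∈ vanishing := by
          convert h using 1
          rw [sub_mul, mul_sub]
          abel
        exact h1
      smul_mem' := fun a b hb => by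
        rw [Set.mem_ofPred_eq, map_smul]
        have h1 : a • b.1 - compressionFamily (a • (ψ b).1) ∈ vanishing := by
          rw [map_smul, ← smul_sub]
          exact vanishing.smul_mem a hb
        exact h1
      star_mem' := fun {b} hb => by
        change (star b).1 - compressionFamily (ψ (star b)).1 ∈ vanishing
        rw [map_star]
        have h1 : star b.1 - compressionFamily (star (ψ b).1) ∈ vanishing := by
          rw [compressionFamily_star, ← star_sub]
          exact star_mem_vanishing hb
        exact h1 }
  have hcont : Continuous fun b : (compressionCover 0).carrier =>
      (b.1 : MatProd 0) - compressionFamily (ψ b).1 :=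
    continuous_subtype_val.sub (continuous_compressionFamily.comp
      (continuous_subtype_val.comp (continuous_starHom ψ)))
  refine (compressionCover 0).mem_of_forall_ι_mem (S := S) (isClosed_vanishing.preimage hcont)
    (fun a => ?_) b
  change ((compressionCover 0).ι a).1 - compressionFamily (ψ ((compressionCover 0).ι a)).1 ∈
    vanishing
  rw [hψ]
  have h1 : compressionSum 0 a - compressionFamily (a : Ell2 →L[ℂ] Ell2) ∈ vanishing := by
    rw [compressionFamily_coe, sub_self]
    exact vanishing.zero_mem
  exact h1

end InductiveLimit

/-! ### The inductive limit of the compression covers -/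

section Limit

/-- The restriction `∏_{n ≥ i} M_n → ∏_{n ≥ j} M_n` for `i ≤ j`. -/
def MatProd.restrict {i j : ℕ} (h : i ≤ j) : MatProd i →⋆ₙₐ[ℂ] MatProd j where
  toFun f := (⟨fun n => MatProd.eval i ⟨n, h.trans n.2⟩ f, memℓp_infty ⟨‖f‖, by
    rintro _ ⟨n, rfl⟩
    exact NonUnitalStarAlgHom.norm_apply_le (MatProd.eval i ⟨n, h.trans n.2⟩) f⟩⟩ :
    lp (fun n : {n : ℕ // j ≤ n} => Mat n) ∞)
  map_smul' _ _ := rfl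
  map_zero' := rfl
  map_add' _ _ := rfl
  map_mul' _ _ := rfl
  map_star' _ := rfl

theorem restrict_mem {i j : ℕ} (h : i ≤ j) (b : cstarGenerated (compressionSum i)) :
    MatProd.restrict h b ∈ cstarGenerated (compressionSum j) :=
  cstarGenerated_le (S := (cstarGenerated (compressionSum j)).comap (MatProd.restrict h))
    ((isClosed_cstarGenerated _).preimage (continuous_starHom (MatProd.restrict h)))
    (mem_cstarGenerated (compressionSum j)) b.2

/-- The morphisms of C⋆-covers between the compression covers. -/
def compressionCover.restrict (i j : ℕ) (h : i ≤ j) :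
    (compressionCover i).carrier →⋆ₙₐ[ℂ] (compressionCover j).carrier :=
  NonUnitalStarAlgHom.codRestrict ((MatProd.restrict h).comp
    (NonUnitalStarSubalgebraClass.subtype (cstarGenerated (compressionSum i)))) _ (restrict_mem h)

theorem compressionCover.restrict_ι (i j : ℕ) (h : i ≤ j) (a : triCompact) :
    compressionCover.restrict i j h ((compressionCover i).ι a) = (compressionCover j).ι a := rfl

variable {D : Type v} [NonUnitalCStarAlgebra D]
  (χ : ∀ i, (compressionCover i).carrier →⋆ₙₐ[ℂ] D)

/-- A compatible family of morphisms out of the compression covers kills the families that vanish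
at infinity. -/
theorem apply_eq_zero_of_mem_vanishing
    (hχ : ∀ i j h b, χ j (compressionCover.restrict i j h b) = χ i b)
    (b : (compressionCover 0).carrier) (hb : b.1 ∈ vanishing) : χ 0 b = 0 := by
  rw [← norm_le_zero_iff]
  refine le_of_forall_pos_le_add fun ε hε => ?_
  rw [zero_add]
  obtain ⟨N, hN⟩ := Metric.tendsto_atTop.1 (mem_vanishing.1 hb) ε hε
  -- Factoring through `R_N` replaces `b` by its tail from `N` on, whose norm is at most `ε`.
  rw [← hχ 0 N N.zero_le]
  refine (NonUnitalStarAlgHom.norm_apply_le (χ N) _).trans ?_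
  refine MatProd.norm_le hε.le fun n => ?_
  have h := hN n n.2
  rw [Real.dist_0_eq_abs, abs_norm] at h
  exact h.le

/-- Compression is a section `s` of `ψ`, and `s (ψ b)` differs from `b` by a null family, which `χ
0` kills. So `χ 0 ∘ s` is a ⋆-homomorphism although `s` is not. -/
theorem exists_hom_of_compatible
    (ψ : (compressionCover 0).carrier →⋆ₙₐ[ℂ] (inclusionCover triCompact).carrier)
    (hψ : ∀ a, ψ ((compressionCover 0).ι a) = (inclusionCover triCompact).ι a)
    (hχ : ∀ i j h b, χ j (compressionCover.restrict i j h b) = χ i b) :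
    ∃ Φ : (inclusionCover triCompact).carrier →⋆ₙₐ[ℂ] D, ∀ b, Φ (ψ b) = χ 0 b := by
  have hcpt : ∀ T : (inclusionCover triCompact).carrier, IsCompactOperator T.1 :=
    fun T => cstarGenerated_subtype_le T.2
  let s : (inclusionCover triCompact).carrier → (compressionCover 0).carrier :=
    fun T => ⟨compressionFamily T.1, compressionFamily_mem (hcpt T)⟩
  have hsψ : ∀ b, χ 0 (s (ψ b)) = χ 0 b := by
    intro b
    have h1 : χ 0 (b - s (ψ b)) = 0 :=
      apply_eq_zero_of_mem_vanishing χ hχ _ (sub_compressionFamily_mem ψ hψ b)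
    rw [map_sub, sub_eq_zero] at h1
    exact h1.symm
  have hψs : ∀ T, ψ (s T) = T := by
    intro T
    have h1 := sub_compressionFamily_mem ψ hψ (s T)
    have h2 : compressionFamily (T.1 - (ψ (s T)).1) ∈ vanishing := by
      rw [map_sub]
      exact h1
    exact Subtype.ext (sub_eq_zero.1 (eq_zero_of_compressionFamily_mem h2)).symm
  refine ⟨
    { toFun := fun T => χ 0 (s T)
      map_smul' := fun a T => ?_
      map_zero' := ?_
      map_add' := fun S T => ?_
      map_mul' := fun S T => ?_
      map_star' := fun T => ?_ }, hsψ⟩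
  · change χ 0 (s (a • T)) = a • χ 0 (s T)
    rw [← map_smul, ← hsψ (a • s T), map_smul, hψs]
  · change χ 0 (s 0) = 0
    rw [← map_zero ψ, hsψ, map_zero]
  · change χ 0 (s (S + T)) = χ 0 (s S) + χ 0 (s T)
    rw [← map_add, ← hsψ (s S + s T), map_add, hψs, hψs]
  · rw [← map_mul, ← hsψ (s S * s T), map_mul, hψs, hψs]
  · rw [← map_star, ← hsψ (star (s T)), map_star, hψs]

theorem isInductiveLimit_compressionCover
    (ψ : ∀ i, (compressionCover i).carrier →⋆ₙₐ[ℂ] (inclusionCover triCompact).carrier)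
    (hψ : ∀ i a, ψ i ((compressionCover i).ι a) = (inclusionCover triCompact).ι a) :
    IsInductiveLimit.{0, v} compressionCover.restrict ψ := by
  refine ⟨fun i j h b => ?_, fun D _ χ hχ => ?_⟩
  · have h1 : (ψ j).comp (compressionCover.restrict i j h) = ψ i :=
      (compressionCover i).hom_ext fun a => by
        rw [NonUnitalStarAlgHom.comp_apply, compressionCover.restrict_ι, hψ, hψ]
    exact congr($h1 b)
  · obtain ⟨Φ, hΦ⟩ := exists_hom_of_compatible χ (ψ 0) (hψ 0) hχ
    have hΦι : ∀ a, Φ ((inclusionCover triCompact).ι a) = χ 0 ((compressionCover 0).ι a) :=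
      fun a => by rw [← hψ 0, hΦ]
    refine ⟨Φ, fun i b => ?_, fun Φ' hΦ' => ?_⟩
    · have h1 : Φ.comp (ψ i) = χ i := (compressionCover i).hom_ext fun a => by
        rw [NonUnitalStarAlgHom.comp_apply, hψ, hΦι, ← hχ 0 i i.zero_le,
          compressionCover.restrict_ι]
      exact congr($h1 b)
    · exact (inclusionCover triCompact).hom_ext fun a => by rw [hΦι, ← hψ 0, hΦ']

end Limit

/-! ### Meets of C⋆-covers -/

section Meets

theorem cls_inclusionCover_le (B : CStarCover.{0} triCompact) :
    (inclusionCover triCompact).cls ≤ B.cls :=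
  toAntisymmetrization_le_toAntisymmetrization_iff.2 (exists_hom_inclusionCover B)

/-- A lower bound supplies morphisms out of every `R_m`. They agree on the generators, hence are
compatible, and so factor through `K`. -/
theorem cls_le_inclusionCover_of_forall_le (x : CStarLat.{0} triCompact)
    (hx : ∀ m, x ≤ (compressionCover m).cls) : x ≤ (inclusionCover triCompact).cls := by
  obtain ⟨D, rfl⟩ := Quotient.exists_rep x
  have hD : ∀ m, ∃ χ : (compressionCover m).carrier →⋆ₙₐ[ℂ] D.carrier,
      ∀ a, χ ((compressionCover m).ι a) = D.ι a := fun m =>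
    toAntisymmetrization_le_toAntisymmetrization_iff.1 (hx m)
  choose χ hχ using hD
  obtain ⟨ψ, hψ⟩ := exists_hom_inclusionCover (compressionCover 0)
  obtain ⟨Φ, hΦ⟩ := exists_hom_of_compatible χ ψ hψ fun i j h b => by
    have h1 : (χ j).comp (compressionCover.restrict i j h) = χ i :=
      (compressionCover i).hom_ext fun a => by
        rw [NonUnitalStarAlgHom.comp_apply, compressionCover.restrict_ι, hχ, hχ]
    exact congr($h1 b)
  refine toAntisymmetrization_le_toAntisymmetrization_iff.2 ⟨Φ, fun a => ?_⟩
  rw [← hψ, hΦ, hχ]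

theorem isGLB_compressionCover :
    IsGLB (Set.range fun m => (compressionCover m).cls) (inclusionCover triCompact).cls := by
  refine ⟨?_, fun x hx => cls_le_inclusionCover_of_forall_le x fun m => hx ⟨m, rfl⟩⟩
  rintro _ ⟨m, rfl⟩
  exact cls_inclusionCover_le _

theorem isGLB_rfdCovers :
    IsGLB (rfdCovers.{0} triCompact) (inclusionCover triCompact).cls := by
  refine ⟨?_, fun x hx => cls_le_inclusionCover_of_forall_le x fun m =>
    hx ⟨compressionCover m, isRFD_cstarGenerated_compressionSum m, rfl⟩⟩
  rintro _ ⟨B, _, rfl⟩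
  exact cls_inclusionCover_le B

/-- The compact operators on `ℓ²(ℕ)` have no nonzero finite-dimensional representation. -/
theorem apply_matrixUnit_eq_zero {n : ℕ}
    (θ : (inclusionCover triCompact).carrier →⋆ₙₐ[ℂ] Matrix (Fin n) (Fin n) ℂ) :
    θ ((inclusionCover triCompact).ι (triUnit 0 0 le_rfl)) = 0 := by
  let E : ℕ → ℕ → (inclusionCover triCompact).carrier := fun i j =>
    ⟨matrixUnit i j, mem_cstarGenerated_subtype (isCompactOperator_rankOne _ _)⟩
  have hE : ∀ i j, E 0 i * E j 0 = if i = j then E 0 0 else 0 := by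
    intro i j
    have h := matrixUnit_mul 0 i j 0
    split_ifs at h ⊢ <;> exact Subtype.ext h
  by_contra h0
  change θ (E 0 0) ≠ 0 at h0
  -- Multiplying a relation among the `θ(E_j0)` by `θ(E_0i)` isolates the `i`-th coefficient times
  -- `θ(E_00)`. Infinitely many independent vectors cannot fit in `M_n`.
  have hli : LinearIndependent ℂ fun i => θ (E i 0) := by
    rw [linearIndependent_iff']
    intro s g hg i hi
    have h1 : θ (E 0 i) * ∑ j ∈ s, g j • θ (E j 0) = g i • θ (E 0 0) := by
      rw [Finset.mul_sum, Finset.sum_eq_single i]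
      · rw [mul_smul_comm, ← map_mul, hE, if_pos rfl]
      · intro j _ hji
        rw [mul_smul_comm, ← map_mul, hE, if_neg hji.symm, map_zero, smul_zero]
      · exact fun h => absurd hi h
    rw [hg, mul_zero] at h1
    exact (smul_eq_zero.1 h1.symm).resolve_right h0
  have := hli.finite
  exact not_finite ℕ

/-- A least element is the greatest lower bound `[K, id]`. It would receive a morphism from `K`, so
all its finite-dimensional representations would kill the nonzero image of `E_00`. -/
theorem not_exists_isLeast_rfdCovers : ¬ ∃ x, IsLeast (rfdCovers.{0} triCompact) x := by
  rintro ⟨x, hx⟩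
  have h1 : x = (inclusionCover triCompact).cls := hx.isGLB.unique isGLB_rfdCovers
  obtain ⟨B, hB, rfl⟩ := hx.1
  obtain ⟨π, hπ⟩ : B ≤ inclusionCover triCompact :=
    toAntisymmetrization_le_toAntisymmetrization_iff.1 h1.le
  have h2 : B.ι (triUnit 0 0 le_rfl) ≠ 0 := by
    rw [← norm_ne_zero_iff, B.completelyIsometric.norm_map]
    exact (norm_matrixUnit 0 0).trans_ne one_ne_zero
  obtain ⟨n, θ, hθ⟩ := hB _ h2
  refine hθ ?_
  rw [← hπ]
  exact apply_matrixUnit_eq_zero (θ.comp π)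

end Meets

end OperatorAlgebra

end

open OperatorAlgebra

theorem theorem5 :
    -- the C⋆-algebra generated by the upper triangular compact operators is `K(ℓ²(ℕ))`, so that
    -- `inclusionCover triCompact` is the C⋆-cover `(K(ℓ²(ℕ)), id)`
    (cstarGenerated (NonUnitalSubalgebraClass.subtype triCompact) : Set (Ell2 →L[ℂ] Ell2)) =
        {T : Ell2 →L[ℂ] Ell2 | IsCompactOperator T} ∧
    -- the meet of all RFD C⋆-covers is `[K(ℓ²(ℕ)), id]`
    IsGLB (rfdCovers.{0} triCompact) (inclusionCover triCompact).cls ∧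
    -- `⊕_{n ≥ m} ρ_n` gives for each `m` an RFD C⋆-cover
    (∃ h : ∀ m, IsCompletelyIsometric (compressionSum m),
      (∀ m, IsRFD (CStarCover.ofHom (compressionSum m) (h m)).carrier) ∧
      -- the meet of these covers is `[K(ℓ²(ℕ)), id]`
      IsGLB (Set.range fun m => (CStarCover.ofHom (compressionSum m) (h m)).cls)
        (inclusionCover triCompact).cls ∧
      -- they form a decreasing chain, whose inductive limit along the morphisms of C⋆-covers
      -- is `(K(ℓ²(ℕ)), id)`
      ∃ (π : ∀ i j, i ≤ j → (CStarCover.ofHom (compressionSum i) (h i)).carrier →⋆ₙₐ[ℂ]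
            (CStarCover.ofHom (compressionSum j) (h j)).carrier)
        (ψ : ∀ i, (CStarCover.ofHom (compressionSum i) (h i)).carrier →⋆ₙₐ[ℂ]
            (inclusionCover triCompact).carrier),
        (∀ i j (hij : i ≤ j) (a : triCompact),
          π i j hij ((CStarCover.ofHom (compressionSum i) (h i)).ι a) =
            (CStarCover.ofHom (compressionSum j) (h j)).ι a) ∧
        (∀ i (a : triCompact), ψ i ((CStarCover.ofHom (compressionSum i) (h i)).ι a) =
          (inclusionCover triCompact).ι a) ∧
        IsInductiveLimit.{0, v} π ψ) ∧
    -- there is no smallest RFD C⋆-cover, i.e. no RFD C⋆-cover lies below all RFD C⋆-covers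
    ¬ ∃ x, IsLeast (rfdCovers.{0} triCompact) x := by
  refine ⟨Set.Subset.antisymm (fun T hT => cstarGenerated_subtype_le hT)
    fun T hT => mem_cstarGenerated_subtype hT, isGLB_rfdCovers,
    ⟨isCompletelyIsometric_compressionSum, isRFD_cstarGenerated_compressionSum,
      isGLB_compressionCover, ?_⟩, not_exists_isLeast_rfdCovers⟩
  choose ψ hψ using fun i => exists_hom_inclusionCover (compressionCover i)
  exact ⟨compressionCover.restrict, ψ, compressionCover.restrict_ι, hψ,
    isInductiveLimit_compressionCover ψ hψ⟩
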